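/- Conventions (Type-2 theory of effectivity). Let $\Sigma$ be a finite alphabet with $0,1\in\Sigma$, $\Sigma^*$ the set of finite words and $\Sigma^\omega$ the set of infinite sequences. Put $\iota(a_1\ldots a_k)=110a_10a_2\ldots 0a_k011$ and $\langle u_1,\ldots,u_n\rangle=\iota(u_1)\cdots\iota(u_n)$ for words; $\langle p_1,\ldots,p_n\rangle=p_1(0)\ldots p_n(0)p_1(1)\ldots p_n(1)\ldots$ for sequences; and $\langle p_0,p_1,\ldots\rangle\langle i,j\rangle=p_i(j)$ with the Cantor pairing $\langle i,j\rangle=(i+j)(i+j+1)/2+j$. Write $u\ll p$ if $\iota(u)$ is a subword of the word or sequence $p$. Computability of partial functions on words and sequences is computability by Type-2 machines. A multi-representation $\gamma$ of $M$ relates sequences $p$ (names) to elements $x$ of $M$, written $x\in\gamma(p)$; a partial function $g$ on $\Sigma^\omega$ realizes a partial function $f$ from $M$ to $M'$ with respect to $(\gamma,\gamma')$ if $f(x)\in\gamma'(g(p))$ whenever $x\in\gamma(p)$ and $x\in\mathrm{dom}(f)$, and $f$ is $(\gamma,\gamma')$-computable if some computable $g$ realizes it. A name of $(x_1,\ldots,x_n)$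 under $[\gamma_1,\ldots,\gamma_n]$ is a sequence $\langle p_1,\ldots,p_n\rangle$ with $x_i\in\gamma_i(p_i)$ for all $i$; similarly for $[\gamma_1,\gamma_2,\ldots]$ and $\langle p_1,p_2,\ldots\rangle$. An effective topological space $\mathbf X=(X,\tau,\beta,\nu)$ is a $T_0$-space $(X,\tau)$ with a partial function $\nu$ from $\Sigma^*$ onto a base $\beta$ of $\tau$. A set $S\subseteq \mathrm{dom}(\nu)^3$ realizes intersection if $\nu(u)\cap\nu(v)=\bigcup\{\nu(w)\mid(u,v,w)\in S\}$ for all $u,v\in\mathrm{dom}(\nu)$. The space is computable if $\mathrm{dom}(\nu)$ is recursive and some r.e. $S$ realizes intersection. $\mathbf X\in\Delta\langle r,s\rangle$ means that $r$ enumerates the graph of the characteristic function of $\mathrm{dom}(\nu)$ and $s$ enumerates some $S$ that realizes intersection; a sequence $(\mathbf X_1,\mathbf X_2,\ldots)$ is $(\nu_{\mathbb N},\Delta)$-computable if a $\Delta$-name of $\mathbf X_n$ can be computed from the word $0^n$, for all $n\ge1$. For $w\in\Sigma^*$ let $w\in\mathrm{dom}(\nu^{\rm fs})$ iff $v\in\mathrm{dom}(\nu)$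 for all $v\ll w$, and then $\nu^{\rm fs}(w)=\{\nu(v)\mid v\ll w\}$. For compact $K\subseteq X$, $K\in\kappa_{\mathbf X}(p)$ iff for all $w\in\Sigma^*$: $w\ll p$ iff ($w\in\mathrm{dom}(\nu^{\rm fs})$ and $K\subseteq\bigcup\nu^{\rm fs}(w)$); and $K\in\tilde\kappa_{\mathbf X}(p)$ iff for all $w$: $w\ll p$ iff ($w\in\mathrm{dom}(\nu^{\rm fs})$, $K\subseteq\bigcup\nu^{\rm fs}(w)$ and $\nu(v)\cap K\ne\emptyset$ for all $v\ll w$). The product $\mathbf X_1\times\mathbf X_2$ is the product space with the base notation $\langle u_1,u_2\rangle\mapsto\nu_1(u_1)\times\nu_2(u_2)$ ($u_i\in\mathrm{dom}(\nu_i)$); $\mathbf X_1\times\cdots\times\mathbf X_n$ is defined inductively as $(\ldots(\mathbf X_1\times\mathbf X_2)\times\cdots)\times\mathbf X_n$; and $\mathbf X_1\times\mathbf X_2\times\cdots$ is the countable product space with the base notation $\langle u_1,\ldots,u_k\rangle\mapsto\nu_1(u_1)\times\cdots\times\nu_k(u_k)\times X_{k+1}\times X_{k+2}\times\cdots$ ($k\ge1$,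 $u_i\in\mathrm{dom}(\nu_i)$). Corollary. Let $\mathbf X_1,\mathbf X_2$ be computable topological spaces in part (1), and let $(\mathbf X_1,\mathbf X_2,\ldots)$ be a $(\nu_{\mathbb N},\Delta)$-computable sequence of topological spaces in parts (2) and (3). For compact sets $K_i\subseteq X_i$: 1. The function $(K_1,K_2)\mapsto K_1\times K_2$ is $([\kappa_{\mathbf X_1},\kappa_{\mathbf X_2}],\kappa_{\mathbf X_1\times\mathbf X_2})$-computable. 2. There is a computable function $f$ such that for every $n\ge1$ the function $q\mapsto f(0^n,q)$ realizes $(K_1,\ldots,K_n)\mapsto K_1\times\cdots\times K_n$ with respect to $([\kappa_{\mathbf X_1},\ldots,\kappa_{\mathbf X_n}],\kappa_{\mathbf X_1\times\cdots\times\mathbf X_n})$. 3. The function $(K_1,K_2,\ldots)\mapsto K_1\times K_2\times\cdots$ is $([\kappa_{\mathbf X_1},\kappa_{\mathbf X_2},\ldots],\kappa_{\mathbf X_1\times\mathbf X_2\times\cdots})$-computable. Statements 1 and 2 hold likewise with $\tilde\kappa$ in place of $\kappa$ throughout. Statement 3 holds likewise with $\tilde\kappa$ in place of $\kappa$ for the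 function restricted to the sequences $(K_1,K_2,\ldots)$ of non-empty compact sets. -/

import Mathlib

open TopologicalSpace

universe u v w

/-! ## Words, sequences and tupling -/

/-- The alphabet: an arbitrary finite alphabet with two distinguished distinct symbols `0`, `1`. -/
abbrev Letter (k : ℕ) : Type := Fin (k + 2)

/-- Finite words over the alphabet. -/
abbrev Word (k : ℕ) : Type := List (Letter k)

/-- Infinite sequences over the alphabet. -/
abbrev OmegaWord (k : ℕ) : Type := ℕ → Letter k

section

variable {k : ℕ}

/-- The wrapping function `ι(a₁a₂…aₙ) = 11 0a₁ 0a₂ … 0aₙ 011`. -/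
def iota (w : Word k) : Word k :=
  [1, 1] ++ (w.flatMap (fun a => [0, a]) ++ [0, 1, 1])

/-- Tupling of words: `⟨u₁,…,uₙ⟩ = ι(u₁)…ι(uₙ)`. -/
def tuple (us : List (Word k)) : Word k := us.flatMap iota

/-- `v ≪ w` for words: `ι(v)` is a subword of `w`. -/
def InWord (v w : Word k) : Prop := iota v <:+: w

/-- `v ≪ p` for sequences: `ι(v)` is a subword of `p`. -/
def InSeq (v : Word k) (p : OmegaWord k) : Prop :=
  ∃ n : ℕ, ∀ (i : ℕ) (h : i < (iota v).length), p (n + i) = (iota v)[i]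

/-- The word `0ⁿ`, the name of the number `n` under the notation `ν_ℕ`. -/
def unary (n : ℕ) : Word k := List.replicate n 0

/-- Finite tupling of sequences (interleaving):
`⟨p₁,…,pₙ⟩ = p₁(0)…pₙ(0) p₁(1)…pₙ(1) p₁(2)…`, for `n + 1` sequences `p 0, …, p n`. -/
def seqTuple {n : ℕ} (p : Fin (n + 1) → OmegaWord k) : OmegaWord k :=
  fun m => p ⟨m % (n + 1), Nat.mod_lt _ n.succ_pos⟩ (m / (n + 1))

/-- The Cantor pairing function `⟨i,j⟩ = (i+j)(i+j+1)/2 + j`. -/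
def cantorPair (i j : ℕ) : ℕ := (i + j) * (i + j + 1) / 2 + j

/-- `IsSeqSeq p r` says that `r = ⟨p₀,p₁,…⟩`, where `⟨p₀,p₁,…⟩⟨i,j⟩ = pᵢ(j)`. -/
def IsSeqSeq (p : ℕ → OmegaWord k) (r : OmegaWord k) : Prop :=
  ∀ i j : ℕ, r (cantorPair i j) = p i j

/-! ## Type-2 machines -/

/-- The content of a one-way input tape; `none` is the blank symbol. -/
abbrev InTape (k : ℕ) : Type := ℕ → Option (Letter k)

/-- The input tape carrying a finite word, followed by blanks. -/
def wordTape (w : Word k) : InTape k := fun n => w[n]?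

/-- The input tape carrying an infinite sequence. -/
def seqTape (p : OmegaWord k) : InTape k := fun n => some (p n)

/-- A Type-2 machine with `m` one-way read-only input tapes and a one-way write-only output tape.
Its work storage always holds a finite object (an element of `Mem`).
In one step it inspects its storage and the symbols under the `m` input heads; from these it
computes the next storage content, which of the input heads move one cell forward,
and at most one symbol that is appended to the output. -/
structure Type2Machine (k m : ℕ) where
  Mem : Type
  [primcodable : Primcodable Mem]
  start : Mem
  step : Mem → (Fin m → Option (Letter k)) → Mem × (Fin m → Bool) × Option (Letter k)
  step_computable : Computable₂ step

namespace Type2Machine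

variable {m : ℕ}

/-- A configuration: storage, positions of the input heads, output written so far. -/
structure Config (M : Type2Machine k m) where
  mem : M.Mem
  head : Fin m → ℕ
  out : Word k

/-- The configuration after `t` steps on the input `y`. -/
def config (M : Type2Machine k m) (y : Fin m → InTape k) : ℕ → M.Config
  | 0 => ⟨M.start, fun _ => 0, []⟩
  | t + 1 =>
    let c := M.config y t
    let r := M.step c.mem (fun i => y i (c.head i))
    ⟨r.1, fun i => if r.2.1 i then c.head i + 1 else c.head i, c.out ++ r.2.2.toList⟩

/-- On the input `y` the machine computes forever and writes the infinite sequence `q`. -/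
def Computes (M : Type2Machine k m) (y : Fin m → InTape k) (q : OmegaWord k) : Prop :=
  ∀ n : ℕ, ∃ t : ℕ, (M.config y t).out[n]? = some (q n)

end Type2Machine

/-- Computability of a partial function from sequences to sequences. -/
def SeqComputable (g : OmegaWord k →. OmegaWord k) : Prop :=
  ∃ M : Type2Machine k 1, ∀ p q, q ∈ g p ↔ M.Computes ![seqTape p] q

/-- Computability of a partial function from words to sequences. -/
def WordComputable (g : Word k →. OmegaWord k) : Prop :=
  ∃ M : Type2Machine k 1, ∀ w q, q ∈ g w ↔ M.Computes ![wordTape w] q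

/-- Computability of a partial function that takes a word and a sequence to a sequence. -/
def WordSeqComputable (g : Word k → OmegaWord k →. OmegaWord k) : Prop :=
  ∃ M : Type2Machine k 2, ∀ w p q, q ∈ g w p ↔ M.Computes ![wordTape w, seqTape p] q

/-! ## Multi-representations and realization -/

/-- A multi-representation by sequences, as a naming relation: `γ p x` means `x ∈ γ(p)`. -/
abbrev MultiRep (k : ℕ) (M : Type*) : Type _ := OmegaWord k → M → Prop

section
variable {M M' : Type*}

/-- The partial function `g` on names realizes the partial function `f`
with respect to `γ` and `γ'`. -/
def Realizes (g : OmegaWord k →. OmegaWord k) (γ : MultiRep k M) (γ' : MultiRep k M') (f : M →. M') : Prop :=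
  ∀ p x, γ p x → ∀ y ∈ f x, ∃ q ∈ g p, γ' q y

/-- `f` is `(γ,γ')`-computable. -/
def RepComputable (γ : MultiRep k M) (γ' : MultiRep k M') (f : M →. M') : Prop :=
  ∃ g : OmegaWord k →. OmegaWord k, SeqComputable g ∧ Realizes g γ γ' f

/-- The multi-representation `[γ₁,γ₂]` of a binary product. -/
def MultiRep.prod (γ : MultiRep k M) (γ' : MultiRep k M') : MultiRep k (M × M') :=
  fun r x => ∃ p p' : OmegaWord k, r = seqTuple ![p, p'] ∧ γ p x.1 ∧ γ' p' x.2

end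

/-- The multi-representation `[γ₁,…,γₙ]` of a finite product. -/
def MultiRep.finProd {n : ℕ} {M : Fin (n + 1) → Type*} (γ : ∀ i, MultiRep k (M i)) :
    MultiRep k (∀ i, M i) :=
  fun r x => ∃ p : Fin (n + 1) → OmegaWord k, r = seqTuple p ∧ ∀ i, γ i (p i) (x i)

/-- The multi-representation `[γ₁,γ₂,…]` of a countable product. -/
def MultiRep.countProd {M : ℕ → Type*} (γ : ∀ i, MultiRep k (M i)) : MultiRep k (∀ i, M i) :=
  fun r x => ∃ p : ℕ → OmegaWord k, IsSeqSeq p r ∧ ∀ i, γ i (p i) (x i)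

/-! ## Injectivity of tupling -/

theorem iota_append_inj : ∀ {a b s t : Word k}, iota a ++ s = iota b ++ t → a = b ∧ s = t := by
  suffices h : ∀ a b s t : Word k,
      a.flatMap (fun c => [0, c]) ++ 0 :: 1 :: 1 :: s
        = b.flatMap (fun c => [0, c]) ++ 0 :: 1 :: 1 :: t → a = b ∧ s = t by
    intro a b s t hab
    refine h a b s t ?_
    simpa [iota] using hab
  intro a
  induction a with
  | nil =>
    intro b s t hab
    cases b with
    | nil => simpa using hab
    | cons c b => cases b <;> simp at hab
  | cons c a ih =>
    intro b s t hab
    cases b with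
    | nil => cases a <;> simp at hab
    | cons d b =>
      simp only [List.flatMap_cons, List.cons_append, List.nil_append, List.cons.injEq,
        true_and] at hab
      obtain ⟨h1, h2⟩ := ih b s t hab.2
      exact ⟨by rw [hab.1, h1], h2⟩

theorem tuple_injective : Function.Injective (tuple : List (Word k) → Word k) := by
  intro a
  induction a with
  | nil =>
    intro b h
    cases b with
    | nil => rfl
    | cons c b => simp [tuple, iota] at h
  | cons c a ih =>
    intro b h
    cases b with
    | nil => simp [tuple, iota] at h
    | cons d b =>
      simp only [tuple, List.flatMap_cons] at h
      obtain ⟨h1, h2⟩ := iota_append_inj h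
      rw [h1, ih h2]

/-! ## Effective topological spaces -/

/-- An effective topological space `(X,τ,β,ν)`: a `T₀` space with a partial function `ν` from
words onto a base `β` of its topology. The partial function is given by its domain `dom` and by
its values on `dom`; outside of `dom` the function `nu` has the fixed value `∅`,
so that `x ∈ nu w` includes `w ∈ dom`. The base is `β = range ν = nu '' dom`. -/
structure EffSpace (k : ℕ) : Type (u + 1) where
  carrier : Type u
  [top : TopologicalSpace carrier]
  t0 : T0Space carrier
  dom : Set (Word k)
  nu : Word k → Set carrier
  nu_outside : ∀ w, w ∉ dom → nu w = ∅
  isBasis : IsTopologicalBasis (nu '' dom)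

namespace EffSpace

instance : CoeSort (EffSpace.{u} k) (Type u) := ⟨carrier⟩

instance (X : EffSpace.{u} k) : TopologicalSpace X := X.top

theorem mem_dom (X : EffSpace.{u} k) {w : Word k} {x : X} (h : x ∈ X.nu w) : w ∈ X.dom := by
  by_contra hw
  rw [X.nu_outside w hw] at h
  exact h

/-- The set `S` of triples of words describes the intersections of base elements:
`S ⊆ dom(ν)³`, and `ν(u) ∩ ν(v) = ⋃ {ν(w) | (u,v,w) ∈ S}` for all `u, v ∈ dom(ν)`. -/
def Intersects (X : EffSpace.{u} k) (S : Set (Word k × Word k × Word k)) : Prop :=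
  (∀ a b c, (a, b, c) ∈ S → a ∈ X.dom ∧ b ∈ X.dom ∧ c ∈ X.dom) ∧
  ∀ a ∈ X.dom, ∀ b ∈ X.dom, X.nu a ∩ X.nu b = {x | ∃ c, (a, b, c) ∈ S ∧ x ∈ X.nu c}

/-- Computable topological spaces. -/
def IsComputable (X : EffSpace.{u} k) : Prop :=
  ComputablePred (fun w => w ∈ X.dom) ∧
  ∃ S : Set (Word k × Word k × Word k), REPred (fun t => t ∈ S) ∧ X.Intersects S

/-- The sequence `r` enumerates the graph of the characteristic function of `A`:
the words `w ≪ r` are the words `⟨u,0⟩` with `u ∈ A` and the words `⟨u,ε⟩` with `u ∉ A`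
(the values `1` and `0` being named by `0¹ = 0` and by `0⁰ = ε`). -/
def EnumeratesCharFun (r : OmegaWord k) (A : Set (Word k)) : Prop :=
  ∀ w, InSeq w r ↔
    ∃ a, (a ∈ A ∧ w = tuple [a, unary 1]) ∨ (a ∉ A ∧ w = tuple [a, unary 0])

/-- The sequence `s` enumerates the set `S` of triples of words. -/
def EnumeratesTriples (s : OmegaWord k) (S : Set (Word k × Word k × Word k)) : Prop :=
  ∀ w, InSeq w s ↔ ∃ a b c, (a, b, c) ∈ S ∧ w = tuple [a, b, c]

/-- The multi-representation `Δ` of the class of effective topological spaces. -/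
def Delta : MultiRep k (EffSpace.{u} k) :=
  fun t X => ∃ r s : OmegaWord k, t = seqTuple ![r, s] ∧ EnumeratesCharFun r X.dom ∧
    ∃ S : Set (Word k × Word k × Word k), EnumeratesTriples s S ∧ X.Intersects S

/-- The sequence of spaces `X₁, X₂, …` is `(ν_ℕ,Δ)`-computable: from `0ⁿ`, `n ≥ 1`, a `Δ`-name
of `Xₙ` can be computed. In Lean, `X i` is the space `X_{i+1}`. -/
def ComputableSequence (X : ℕ → EffSpace.{u} k) : Prop :=
  ∃ g : Word k →. OmegaWord k, WordComputable g ∧ ∀ i, ∃ q ∈ g (unary (i + 1)), Delta q (X i)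

/-! ### Multi-representations of the compact sets -/

/-- The word `w` is in the domain of `ν^fs`. -/
def FsDom (X : EffSpace.{u} k) (w : Word k) : Prop := ∀ a, InWord a w → a ∈ X.dom

/-- The union `⋃ ν^fs(w)` of the sets `ν(a)`, `a ≪ w`. -/
def fsUnion (X : EffSpace.{u} k) (w : Word k) : Set X := {x | ∃ a, InWord a w ∧ x ∈ X.nu a}

/-- The multi-representation `κ_X`: a name of `K` lists all finite covers of `K` by base sets. -/
def kappa (X : EffSpace.{u} k) : MultiRep k (Compacts X) :=
  fun p K => ∀ w, InSeq w p ↔ (X.FsDom w ∧ (K : Set X) ⊆ X.fsUnion w)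

/-- The multi-representation `κ̃_X`: a name of `K` lists all minimal finite covers of `K`, that is,
the finite covers by base sets each of which intersects `K`. -/
def kappaMin (X : EffSpace.{u} k) : MultiRep k (Compacts X) :=
  fun p K => ∀ w, InSeq w p ↔
    (X.FsDom w ∧ (K : Set X) ⊆ X.fsUnion w ∧ ∀ a, InWord a w → (X.nu a ∩ (K : Set X)).Nonempty)

/-! ### Products of spaces -/

/-- The set that `⟨a,b⟩` denotes in a binary product: `ν₁(a) × ν₂(b)`. -/
def prodNu (X : EffSpace.{u} k) (Y : EffSpace.{v} k) (w : Word k) : Set (X × Y) :=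
  {x | ∃ a b, w = tuple [a, b] ∧ x.1 ∈ X.nu a ∧ x.2 ∈ Y.nu b}

theorem prodNu_tuple (X : EffSpace.{u} k) (Y : EffSpace.{v} k) (a b : Word k) :
    prodNu X Y (tuple [a, b]) = X.nu a ×ˢ Y.nu b := by
  ext x
  constructor
  · rintro ⟨a', b', h, h1, h2⟩
    have h' := tuple_injective h
    simp only [List.cons.injEq, and_true] at h'
    rw [h'.1, h'.2]
    exact ⟨h1, h2⟩
  · rintro ⟨h1, h2⟩
    exact ⟨a, b, rfl, h1, h2⟩

/-- The product `X × Y` of two effective topological spaces. -/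
def prod (X : EffSpace.{u} k) (Y : EffSpace.{v} k) : EffSpace.{max u v} k where
  carrier := X × Y
  t0 := by
    have := X.t0
    have := Y.t0
    infer_instance
  dom := {w | ∃ a ∈ X.dom, ∃ b ∈ Y.dom, w = tuple [a, b]}
  nu := prodNu X Y
  nu_outside := by
    intro w hw
    ext x
    simp only [Set.mem_empty_iff_false, iff_false]
    rintro ⟨a, b, h, h1, h2⟩
    exact hw ⟨a, X.mem_dom h1, b, Y.mem_dom h2, h⟩
  isBasis := by
    have h := X.isBasis.prod Y.isBasis
    convert h using 1
    ext U
    constructor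
    · rintro ⟨w, ⟨a, ha, b, hb, rfl⟩, rfl⟩
      exact ⟨_, ⟨a, ha, rfl⟩, _, ⟨b, hb, rfl⟩, (prodNu_tuple X Y a b).symm⟩
    · rintro ⟨_, ⟨a, ha, rfl⟩, _, ⟨b, hb, rfl⟩, rfl⟩
      exact ⟨_, ⟨a, ha, b, hb, rfl⟩, prodNu_tuple X Y a b⟩

/-- The finite products `X'₁ = X₁`, `X'_{n+1} = X'_n × X_{n+1}`. In Lean, `X i` is `X_{i+1}`
and `finProd X n` is `X'_{n+1}`. -/
def finProd (X : ℕ → EffSpace.{u} k) : ℕ → EffSpace.{u} k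
  | 0 => X 0
  | n + 1 => (finProd X n).prod (X (n + 1))

/-- The set that `⟨u₁,…,uₙ⟩`, `n ≥ 1`, denotes in a countable product:
`ν₁(u₁) × … × νₙ(uₙ) × X_{n+1} × X_{n+2} × …`. -/
def countNu (X : ℕ → EffSpace.{u} k) (w : Word k) : Set (∀ i, X i) :=
  {x | ∃ us : List (Word k), us ≠ [] ∧ w = tuple us ∧
    ∀ (i : ℕ) (h : i < us.length), x i ∈ (X i).nu us[i]}

theorem countNu_tuple (X : ℕ → EffSpace.{u} k) {us : List (Word k)} (hus : us ≠ []) :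
    countNu X (tuple us) = {x | ∀ (i : ℕ) (h : i < us.length), x i ∈ (X i).nu us[i]} := by
  ext x
  constructor
  · rintro ⟨vs, -, h, h1⟩
    have h' := tuple_injective h
    subst h'
    exact h1
  · intro h
    exact ⟨us, hus, rfl, h⟩

/-- The countable product `X₁ × X₂ × …` of effective topological spaces. -/
def countProd (X : ℕ → EffSpace.{u} k) : EffSpace.{u} k where
  carrier := ∀ i, X i
  t0 := by
    have := fun i => (X i).t0
    infer_instance
  dom := {w | ∃ us : List (Word k), us ≠ [] ∧ w = tuple us ∧
    ∀ (i : ℕ) (h : i < us.length), us[i] ∈ (X i).dom}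
  nu := countNu X
  nu_outside := by
    intro w hw
    ext x
    simp only [Set.mem_empty_iff_false, iff_false]
    rintro ⟨us, h0, h1, h2⟩
    exact hw ⟨us, h0, h1, fun i h => (X i).mem_dom (h2 i h)⟩
  isBasis := by
    refine isTopologicalBasis_of_isOpen_of_nhds ?_ ?_
    · rintro _ ⟨w, ⟨us, h0, rfl, h1⟩, rfl⟩
      rw [countNu_tuple X h0]
      have : {x : ∀ i, X i | ∀ (i : ℕ) (h : i < us.length), x i ∈ (X i).nu us[i]}
          = ⋂ i : Fin us.length, (fun x : ∀ i, X i => x i) ⁻¹' (X i).nu us[i] := by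
        ext x
        simp only [Set.mem_ofPred_eq, Set.mem_iInter, Set.mem_preimage]
        exact ⟨fun h i => h i i.2, fun h i hi => h ⟨i, hi⟩⟩
      rw [this]
      refine isOpen_iInter_of_finite fun i => ?_
      exact ((X i).isBasis.isOpen ⟨_, h1 i i.2, rfl⟩).preimage (continuous_apply (i : ℕ))
    · intro x U hx hU
      obtain ⟨_, ⟨V, F, hV, rfl⟩, hxV, hVU⟩ :=
        (isTopologicalBasis_pi fun i => (X i).isBasis).exists_subset_of_mem_open hx hU
      have hex : ∀ i, ∃ a ∈ (X i).dom, x i ∈ (X i).nu a ∧ (i ∈ F → (X i).nu a = V i) := by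
        intro i
        by_cases hi : i ∈ F
        · obtain ⟨a, ha, h⟩ := hV i hi
          exact ⟨a, ha, by rw [h]; exact hxV i hi, fun _ => h⟩
        · obtain ⟨_, ⟨a, ha, rfl⟩, h, -⟩ :=
            (X i).isBasis.exists_subset_of_mem_open (Set.mem_univ (x i)) isOpen_univ
          exact ⟨a, ha, h, fun h' => absurd h' hi⟩
      choose a ha hxa haV using hex
      have h0 : (List.range (F.sup id + 1)).map a ≠ [] := by simp
      refine ⟨_, ⟨tuple ((List.range (F.sup id + 1)).map a), ⟨_, h0, rfl, ?_⟩, rfl⟩, ?_, ?_⟩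
      · intro i h
        simpa using ha i
      · rw [countNu_tuple X h0]
        intro i h
        simpa using hxa i
      · rw [countNu_tuple X h0]
        intro y hy
        refine hVU fun i hi => ?_
        have hle : i ≤ F.sup id := Finset.le_sup (f := id) hi
        have := hy i (by simp; omega)
        rw [← haV i hi]
        simpa using this

/-! ### Products of compact sets -/

/-- `(K₁,K₂) ↦ K₁ × K₂`. -/
def prodCompacts (X : EffSpace.{u} k) (Y : EffSpace.{v} k) (K : Compacts X × Compacts Y) :
    Compacts (X.prod Y) :=
  ⟨((K.1 : Set X) ×ˢ (K.2 : Set Y) : Set (X × Y)), K.1.isCompact.prod K.2.isCompact⟩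

/-- `(K₁,…,Kₙ) ↦ K₁ × … × Kₙ`; here `n + 1` factors are multiplied. -/
def finProdCompacts (X : ℕ → EffSpace.{u} k) :
    (n : ℕ) → (∀ i : Fin (n + 1), Compacts (X i)) → Compacts (finProd X n)
  | 0, K => K 0
  | n + 1, K =>
    prodCompacts (finProd X n) (X (n + 1))
      (finProdCompacts X n (fun i => K i.castSucc), K (Fin.last (n + 1)))

/-- `(K₁,K₂,…) ↦ K₁ × K₂ × …`. -/
def countProdCompacts (X : ℕ → EffSpace.{u} k) (K : ∀ i, Compacts (X i)) :
    Compacts (countProd X) :=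
  ⟨(Set.univ.pi fun i => (K i : Set (X i)) : Set (∀ i, X i)),
    isCompact_univ_pi fun i => (K i).isCompact⟩

end EffSpace

end

/-! ## Primitive recursive functions -/

/-! Only neighbourhood information matters. Replace a point `x` by its trace, the set of words `a`
with `x ∈ ν(a)`, and a compact set by the traces of its points. Both multi-representations then take
one form (`IsCoverName`): a name lists the words whose members `a ≪ w` all lie in a set `D` and meet
every trace. Here `D` is the domain of `ν` for `κ`, and the union of the traces for `κ̃`
(`kappa_iff`, `kappaMin_iff`). Since any element of `D` may be added to a finite cover, `D` can be
read off the name (`IsCoverName.exists_inWord_iff`), and one procedure serves both cases.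

Inclusion of base sets is not semidecidable in general, but a set `S` realizing intersection
generates a semidecidable formal inclusion (`FormalSub`): a triple `(a, b, c)` puts `c` below `a`
and below `b`. It implies actual inclusion, and a point lying in finitely many base sets has a base
neighbourhood formally below all of them (`isCompactTrace`).

A finite family `w` of boxes covers the product iff there are listed covers of finitely many factors
such that every choice of one member `c i` from each of them is, coordinatewise, formally below some
box of `w` (`ProductCover`). If this holds, a point of the product picks out such a choice and lies
in the corresponding box. Conversely, give each point of a factor a neighbourhood formally below
those `i`-th sides of boxes of `w` that contain the point, and let finitely many of these
neighbourhoods cover the factor. A choice from these covers comes from a point of the product; that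
point lies in some box of `w`, and by construction the chosen neighbourhoods are formally below its
sides. Compactness is thus used one factor at a time. An empty factor has an empty cover, which
leaves no choice to check.

For `κ̃` the words that meet the product must in addition be exactly those whose sides meet the
factors (`sUnion_boxes`). A box in a countable product says nothing about the later factors, hence
the restriction to non-empty sets there; a box in a finite product mentions every factor.

The criterion is built from semidecidable conditions by conjunction, existential quantification and
bounded universal quantification (`OracleSemidec.productCover`), and a Type-2 machine can list every
set of words that is semidecidable from its input (`exists_enumerator`). For a computable sequence
of spaces, simulating the machine that produces the `Δ`-names makes the sets `S` semidecidable
uniformly in the index (`ComputableSequence.exists_intersects`). -/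

section PrimrecCalculus

variable {α β γ σ : Type*} [Primcodable α] [Primcodable β] [Primcodable γ] [Primcodable σ]

attribute [fun_prop] Primrec
attribute [fun_prop] Primrec.id Primrec.const Primrec.comp Primrec.pair

namespace Primrec

@[fun_prop]
theorem fst_comp {f : α → β × γ} (hf : Primrec f) : Primrec fun a => (f a).1 := fst.comp hf

@[fun_prop]
theorem snd_comp {f : α → β × γ} (hf : Primrec f) : Primrec fun a => (f a).2 := snd.comp hf

@[fun_prop]
theorem append_comp {f g : α → List β} (hf : Primrec f) (hg : Primrec g) :
    Primrec fun a => f a ++ g a := list_append.comp hf hg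

@[fun_prop]
theorem cons_comp {f : α → β} {g : α → List β} (hf : Primrec f) (hg : Primrec g) :
    Primrec fun a => f a :: g a := list_cons.comp hf hg

@[fun_prop]
theorem some_comp {f : α → β} (hf : Primrec f) : Primrec fun a => some (f a) :=
  option_some.comp hf

@[fun_prop]
theorem map_comp {f : α → List β} {g : α → β → γ} (hf : Primrec f)
    (hg : Primrec fun p : α × β => g p.1 p.2) : Primrec fun a => (f a).map (g a) :=
  list_map hf hg

@[fun_prop]
theorem flatMap_comp {f : α → List β} {g : α → β → List γ} (hf : Primrec f)
    (hg : Primrec fun p : α × β => g p.1 p.2) : Primrec fun a => (f a).flatMap (g a) :=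
  list_flatMap hf hg

@[fun_prop]
theorem foldr_comp {f : α → List β} {g : α → σ} {h : α → β → σ → σ} (hf : Primrec f)
    (hg : Primrec g) (hh : Primrec fun p : α × β × σ => h p.1 p.2.1 p.2.2) :
    Primrec fun a => (f a).foldr (h a) (g a) :=
  list_foldr (h := fun a p => h a p.1 p.2) hf hg hh

@[fun_prop]
theorem foldl_comp {f : α → List β} {g : α → σ} {h : α → σ → β → σ} (hf : Primrec f)
    (hg : Primrec g) (hh : Primrec fun p : α × σ × β => h p.1 p.2.1 p.2.2) :
    Primrec fun a => (f a).foldl (h a) (g a) :=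
  list_foldl (h := fun a p => h a p.1 p.2) hf hg hh

@[fun_prop]
theorem length_comp {f : α → List β} (hf : Primrec f) : Primrec fun a => (f a).length :=
  list_length.comp hf

@[fun_prop]
theorem range_comp {f : α → ℕ} (hf : Primrec f) : Primrec fun a => List.range (f a) :=
  list_range.comp hf

@[fun_prop]
theorem take_comp {f : α → ℕ} {g : α → List β} (hf : Primrec f) (hg : Primrec g) :
    Primrec fun a => (g a).take (f a) := list_take.comp hf hg

@[fun_prop]
theorem getElem?_comp {f : α → ℕ} {g : α → List β} (hf : Primrec f) (hg : Primrec g) :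
    Primrec fun a => (g a)[f a]? := list_getElem?.comp hg hf

@[fun_prop]
theorem headI_comp [Inhabited β] {f : α → List β} (hf : Primrec f) :
    Primrec fun a => (f a).headI := list_headI.comp hf

@[fun_prop]
theorem tail_comp {f : α → List β} (hf : Primrec f) : Primrec fun a => (f a).tail :=
  list_tail.comp hf

@[fun_prop]
theorem getD_comp {f : α → Option β} {g : α → β} (hf : Primrec f) (hg : Primrec g) :
    Primrec fun a => (f a).getD (g a) := option_getD.comp hf hg

@[fun_prop]
theorem elim_comp {f : α → Option β} {g : α → γ} {h : α → β → γ} (hf : Primrec f)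
    (hg : Primrec g) (hh : Primrec fun p : α × β => h p.1 p.2) :
    Primrec fun a => (f a).elim (g a) (h a) :=
  (option_casesOn hf hg hh).of_eq fun a => by cases f a <;> rfl

@[fun_prop]
theorem decode_comp {f : α → ℕ} (hf : Primrec f) :
    Primrec fun a => (Encodable.decode (f a) : Option β) := Primrec.decode.comp hf

@[fun_prop]
theorem add_comp {f g : α → ℕ} (hf : Primrec f) (hg : Primrec g) :
    Primrec fun a => f a + g a := nat_add.comp hf hg

@[fun_prop]
theorem mul_comp {f g : α → ℕ} (hf : Primrec f) (hg : Primrec g) :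
    Primrec fun a => f a * g a := nat_mul.comp hf hg

@[fun_prop]
theorem div_comp {f g : α → ℕ} (hf : Primrec f) (hg : Primrec g) :
    Primrec fun a => f a / g a := nat_div.comp hf hg

@[fun_prop]
theorem and_comp {f g : α → Bool} (hf : Primrec f) (hg : Primrec g) :
    Primrec fun a => f a && g a := Primrec.and.comp hf hg

@[fun_prop]
theorem or_comp {f g : α → Bool} (hf : Primrec f) (hg : Primrec g) :
    Primrec fun a => f a || g a := Primrec.or.comp hf hg

@[fun_prop]
theorem not_comp {f : α → Bool} (hf : Primrec f) : Primrec fun a => !f a := Primrec.not.comp hf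

@[fun_prop]
theorem cond_comp {c : α → Bool} {f g : α → σ} (hc : Primrec c) (hf : Primrec f)
    (hg : Primrec g) : Primrec fun a => bif c a then f a else g a := cond hc hf hg

@[fun_prop]
theorem decide_eq_comp [DecidableEq β] {f g : α → β} (hf : Primrec f) (hg : Primrec g) :
    Primrec fun a => decide (f a = g a) := (Primrec.eq.comp hf hg).decide

@[fun_prop]
theorem decide_lt_comp {f g : α → ℕ} (hf : Primrec f) (hg : Primrec g) :
    Primrec fun a => decide (f a < g a) := (Primrec.nat_lt.comp hf hg).decide

@[fun_prop]
theorem all_comp {f : α → List β} {g : α → β → Bool} (hf : Primrec f)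
    (hg : Primrec fun p : α × β => g p.1 p.2) : Primrec fun a => (f a).all (g a) := by
  have : Primrec fun a => (f a).foldr (fun b r => g a b && r) true := by fun_prop
  refine this.of_eq fun a => ?_
  induction f a <;> simp_all

@[fun_prop]
theorem any_comp {f : α → List β} {g : α → β → Bool} (hf : Primrec f)
    (hg : Primrec fun p : α × β => g p.1 p.2) : Primrec fun a => (f a).any (g a) := by
  have : Primrec fun a => (f a).foldr (fun b r => g a b || r) false := by fun_prop
  refine this.of_eq fun a => ?_
  induction f a <;> simp_all

@[fun_prop]
theorem filter_comp {f : α → List β} {g : α → β → Bool} (hf : Primrec f)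
    (hg : Primrec fun p : α × β => g p.1 p.2) : Primrec fun a => (f a).filter (g a) := by
  have : Primrec fun a => (f a).flatMap fun b => bif g a b then [b] else [] := by fun_prop
  refine this.of_eq fun a => ?_
  induction f a with
  | nil => rfl
  | cons b l ih =>
    rw [List.flatMap_cons, ih, List.filter_cons]
    cases g a b <;> simp

end Primrec

/-- Kleene's normal form: a recursively enumerable predicate is
the projection of a primitive recursive one. -/
theorem REPred.exists_primrec {P : α → Prop} (hP : REPred P) :
    ∃ Q : α × ℕ → Bool, Primrec Q ∧ (∀ a m n, m ≤ n → Q (a, m) → Q (a, n)) ∧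
      ∀ a, P a ↔ ∃ n, Q (a, n) := by
  obtain ⟨c, hc⟩ := Nat.Partrec.Code.exists_code.1 hP
  refine ⟨fun p => (Nat.Partrec.Code.evaln p.2 c (Encodable.encode p.1)).isSome, ?_, ?_, ?_⟩
  · exact Primrec.option_isSome.comp (Nat.Partrec.Code.primrec_evaln.comp
      ((Primrec.snd.pair (Primrec.const c)).pair (Primrec.encode.comp Primrec.fst)))
  · intro a m n hmn h
    obtain ⟨x, hx⟩ := Option.isSome_iff_exists.1 h
    exact Option.isSome_iff_exists.2 ⟨x, Nat.Partrec.Code.evaln_mono hmn hx⟩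
  · intro a
    have h1 : P a ↔ ∃ x, x ∈ Nat.Partrec.Code.eval c (Encodable.encode a) := by
      rw [hc]
      simp
    rw [h1]
    constructor
    · rintro ⟨x, hx⟩
      obtain ⟨n, hn⟩ := Nat.Partrec.Code.evaln_complete.1 hx
      exact ⟨n, Option.isSome_iff_exists.2 ⟨x, hn⟩⟩
    · rintro ⟨n, hn⟩
      obtain ⟨x, hx⟩ := Option.isSome_iff_exists.1 hn
      exact ⟨x, Nat.Partrec.Code.evaln_complete.2 ⟨n, hx⟩⟩

end PrimrecCalculus

/-! ## Semidecidability relative to an oracle -/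

section Oracle

variable {α β γ : Type*}

/-- The first `n` values of `y`. -/
def history (y : ℕ → β) (n : ℕ) : List β := (List.range n).map y

@[simp] theorem length_history (y : ℕ → β) (n : ℕ) : (history y n).length = n := by
  simp [history]

theorem history_take (y : ℕ → β) {m n : ℕ} (h : m ≤ n) : (history y n).take m = history y m := by
  rw [history, ← List.map_take, List.take_range, min_eq_left h, history]

theorem history_prefix (y : ℕ → β) {m n : ℕ} (h : m ≤ n) : history y m <+: history y n := by
  rw [← history_take y h]
  exact List.take_prefix _ _

theorem history_succ (y : ℕ → β) (n : ℕ) : history y (n + 1) = history y n ++ [y n] := by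
  simp [history, List.range_succ]

variable [Primcodable α] [Primcodable β] [Primcodable γ]

/-- `P a y` is semidecidable from `a` and finite prefixes of the sequence `y`. -/
def OracleSemidec (P : α → (ℕ → β) → Prop) : Prop :=
  ∃ Q : α × List β → Bool, Primrec Q ∧ (∀ a l l', l <+: l' → Q (a, l) → Q (a, l')) ∧
    ∀ a y, P a y ↔ ∃ n, Q (a, history y n)

namespace OracleSemidec

theorem of_iff {P P' : α → (ℕ → β) → Prop} (h : OracleSemidec P) (H : ∀ a y, P' a y ↔ P a y) :
    OracleSemidec P' := by
  have : P' = P := by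
    funext a y
    exact propext (H a y)
  rwa [this]

/-- The length of the oracle prefix serves as the step bound of the normal form; its symbols are
ignored. -/
theorem of_re {P : α → Prop} (hP : REPred P) :
    OracleSemidec fun a (_ : ℕ → β) => P a := by
  obtain ⟨Q, hQ, hmono, h⟩ := hP.exists_primrec
  refine ⟨fun p => Q (p.1, p.2.length), by fun_prop, fun a l l' hl => hmono _ _ _ hl.length_le, ?_⟩
  intro a y
  simp [h]

theorem of_primrec {f : α → Bool} (hf : Primrec f) :
    OracleSemidec fun a (_ : ℕ → β) => f a = true := by
  refine ⟨fun p => f p.1, by fun_prop, fun a l l' _ h => h, ?_⟩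
  intro a y
  simp

theorem eq [DecidableEq γ] {f g : α → γ} (hf : Primrec f) (hg : Primrec g) :
    OracleSemidec fun a (_ : ℕ → β) => f a = g a :=
  (of_primrec (f := fun a => decide (f a = g a)) (by fun_prop)).of_iff fun a y => by simp

theorem lt {f g : α → ℕ} (hf : Primrec f) (hg : Primrec g) :
    OracleSemidec fun a (_ : ℕ → β) => f a < g a :=
  (of_primrec (f := fun a => decide (f a < g a)) (by fun_prop)).of_iff fun a y => by simp

/-- Asking for one value of the oracle. -/
theorem query {f : α → ℕ} {R : α → β → Bool} (hf : Primrec f)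
    (hR : Primrec fun p : α × β => R p.1 p.2) :
    OracleSemidec fun a (y : ℕ → β) => R a (y (f a)) = true := by
  -- A prefix too short to contain the queried value rejects, which keeps the test monotone.
  refine ⟨fun p => (p.2[f p.1]?).elim false (R p.1), ?_, ?_, ?_⟩
  · have : Primrec fun p : (α × List β) × β => R p.1.1 p.2 :=
      hR.comp (f := fun p : α × β => R p.1 p.2) (g := fun p : (α × List β) × β => (p.1.1, p.2))
        (by fun_prop)
    fun_prop
  · rintro a l l' ⟨t, rfl⟩ h
    dsimp only at h ⊢
    cases hl : l[f a]? with
    | none => simp [hl] at h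
    | some b =>
      obtain ⟨h1, -⟩ := List.getElem?_eq_some_iff.1 hl
      rw [List.getElem?_append_left h1, hl]
      simpa [hl] using h
  · intro a y
    constructor
    · intro h
      refine ⟨f a + 1, ?_⟩
      simpa [history] using h
    · rintro ⟨n, hn⟩
      by_cases hlt : f a < n
      · simpa [history, hlt] using hn
      · simp [history, hlt] at hn

theorem comp {P : γ → (ℕ → β) → Prop} (h : OracleSemidec P) {f : α → γ} (hf : Primrec f) :
    OracleSemidec fun a y => P (f a) y := by
  obtain ⟨Q, hQ, hmono, h⟩ := h
  exact ⟨fun p => Q (f p.1, p.2), by fun_prop, fun a => hmono (f a), fun a => h (f a)⟩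

theorem and {P P' : α → (ℕ → β) → Prop} (h : OracleSemidec P) (h' : OracleSemidec P') :
    OracleSemidec fun a y => P a y ∧ P' a y := by
  obtain ⟨Q, hQ, hmono, h⟩ := h
  obtain ⟨Q', hQ', hmono', h'⟩ := h'
  refine ⟨fun p => Q p && Q' p, by fun_prop, ?_, ?_⟩
  · intro a l l' hl
    simp only [Bool.and_eq_true]
    exact fun H => ⟨hmono a l l' hl H.1, hmono' a l l' hl H.2⟩
  · intro a y
    simp only [Bool.and_eq_true, h, h']
    constructor
    · rintro ⟨⟨m, hm⟩, n, hn⟩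
      exact ⟨max m n, hmono _ _ _ (history_prefix y (le_max_left m n)) hm,
        hmono' _ _ _ (history_prefix y (le_max_right m n)) hn⟩
    · rintro ⟨n, h1, h2⟩
      exact ⟨⟨n, h1⟩, n, h2⟩

theorem or {P P' : α → (ℕ → β) → Prop} (h : OracleSemidec P) (h' : OracleSemidec P') :
    OracleSemidec fun a y => P a y ∨ P' a y := by
  obtain ⟨Q, hQ, hmono, h⟩ := h
  obtain ⟨Q', hQ', hmono', h'⟩ := h'
  refine ⟨fun p => Q p || Q' p, by fun_prop, ?_, ?_⟩
  · intro a l l' hl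
    simp only [Bool.or_eq_true]
    exact Or.imp (hmono a l l' hl) (hmono' a l l' hl)
  · intro a y
    simp only [Bool.or_eq_true, h, h', exists_or]

/-- Dovetailing: a prefix of length `n` tests the witnesses with codes below `n`, so a longer prefix
enlarges both the search range and the oracle information. -/
theorem ex {P : α → γ → (ℕ → β) → Prop}
    (h : OracleSemidec fun (p : α × γ) y => P p.1 p.2 y) :
    OracleSemidec fun a y => ∃ c, P a c y := by
  obtain ⟨Q, hQ, hmono, h⟩ := h
  refine ⟨fun p => (List.range p.2.length).any fun j =>
      (Encodable.decode j : Option γ).elim false fun c => Q ((p.1, c), p.2), ?_, ?_, ?_⟩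
  · have : Primrec fun p : ((α × List β) × ℕ) × γ => Q ((p.1.1.1, p.2), p.1.1.2) := by fun_prop
    fun_prop
  · intro a l l' hl
    simp only [List.any_eq_true, List.mem_range]
    rintro ⟨j, hj, hQj⟩
    refine ⟨j, hj.trans_le hl.length_le, ?_⟩
    cases hd : (Encodable.decode j : Option γ) with
    | none => simp [hd] at hQj
    | some c =>
      rw [hd] at hQj
      exact hmono _ _ _ hl hQj
  · intro a y
    simp only [List.any_eq_true, List.mem_range, length_history]
    constructor
    · rintro ⟨c, hc⟩
      obtain ⟨n, hn⟩ := (h (a, c) y).1 hc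
      refine ⟨max n (Encodable.encode c + 1), Encodable.encode c, by omega, ?_⟩
      rw [Encodable.encodek]
      exact hmono _ _ _ (history_prefix y (le_max_left _ _)) hn
    · rintro ⟨n, j, hj, hQj⟩
      cases hd : (Encodable.decode j : Option γ) with
      | none => simp [hd] at hQj
      | some c =>
        rw [hd] at hQj
        exact ⟨c, (h (a, c) y).2 ⟨n, hQj⟩⟩

theorem all_mem {P : α → γ → (ℕ → β) → Prop} {f : α → List γ} (hf : Primrec f)
    (h : OracleSemidec fun (p : α × γ) y => P p.1 p.2 y) :
    OracleSemidec fun a y => ∀ c ∈ f a, P a c y := by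
  obtain ⟨Q, hQ, hmono, h⟩ := h
  refine ⟨fun p => (f p.1).all fun c => Q ((p.1, c), p.2), by fun_prop, ?_, ?_⟩
  · intro a l l' hl
    simp only [List.all_eq_true]
    exact fun H c hc => hmono _ _ _ hl (H c hc)
  · intro a y
    simp only [List.all_eq_true]
    constructor
    · intro H
      have H' : ∀ c, ∃ n, c ∈ f a → Q ((a, c), history y n) := by
        intro c
        by_cases hc : c ∈ f a
        · obtain ⟨n, hn⟩ := (h (a, c) y).1 (H c hc)
          exact ⟨n, fun _ => hn⟩
        · exact ⟨0, fun h => absurd h hc⟩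
      choose n hn using H'
      -- Finitely many tests have a common stage; the sum of their stages bounds each of them.
      obtain ⟨N, hN⟩ : ∃ N, ∀ c ∈ f a, n c ≤ N := by
        refine ⟨((f a).map n).sum, fun c hc => ?_⟩
        exact List.single_le_sum (by simp) _ (List.mem_map_of_mem hc)
      exact ⟨N, fun c hc => hmono _ _ _ (history_prefix y (hN c hc)) (hn c hc)⟩
    · rintro ⟨n, hn⟩ c hc
      exact (h (a, c) y).2 ⟨n, hn c hc⟩

theorem all_lt {P : α → ℕ → (ℕ → β) → Prop} {f : α → ℕ} (hf : Primrec f)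
    (h : OracleSemidec fun (p : α × ℕ) y => P p.1 p.2 y) :
    OracleSemidec fun a y => ∀ i < f a, P a i y :=
  (all_mem (f := fun a => List.range (f a)) (by fun_prop) h).of_iff fun a y => by simp

/-- Semidecidable families of relations are closed under reflexive transitive closure. -/
theorem reflTransGen {R : α → γ → γ → (ℕ → β) → Prop} [DecidableEq γ]
    (h : OracleSemidec fun (p : α × γ × γ) y => R p.1 p.2.1 p.2.2 y) :
    OracleSemidec fun (p : α × γ × γ) y =>
      Relation.ReflTransGen (fun c d => R p.1 c d y) p.2.1 p.2.2 := by
  -- A chain is witnessed by the list `l` of its nodes after the first; its `i`-th link leads from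
  -- entry `i` of `p.2.1 :: l` to entry `i` of `l`.
  have key : OracleSemidec fun (p : α × γ × γ) (y : ℕ → β) => ∃ l : List γ,
      ((p.2.1 :: l)[l.length]? = some p.2.2 ∧ ∀ i < l.length, ∃ c d, (p.2.1 :: l)[i]? = some c ∧
        l[i]? = some d ∧ R p.1 c d y) := by
    refine ex (and (eq (by fun_prop) (by fun_prop))
      (all_lt (by fun_prop) (ex (ex (and ?_ (and ?_ ?_))))))
    · exact eq (by fun_prop) (by fun_prop)
    · exact eq (by fun_prop) (by fun_prop)
    · exact comp (f := fun q : (((((α × γ × γ) × List γ) × ℕ) × γ) × γ) =>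
        (q.1.1.1.1.1, q.1.2, q.2)) h (by fun_prop)
  refine key.of_iff fun p y => ?_
  obtain ⟨a, c, d⟩ := p
  dsimp only
  constructor
  · intro H
    induction H using Relation.ReflTransGen.head_induction_on with
    | refl => exact ⟨[], by simp⟩
    | head h1 _ ih =>
      obtain ⟨l, hl, hR⟩ := ih
      refine ⟨_ :: l, by simpa using hl, ?_⟩
      intro i hi
      cases i with
      | zero => exact ⟨_, _, rfl, rfl, h1⟩
      | succ i => simpa using hR i (by simpa using hi)
  · rintro ⟨l, hl, hR⟩
    induction l generalizing c with
    | nil =>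
      simp at hl
      rw [hl]
    | cons e l ih =>
      obtain ⟨c', d', h1, h2, h3⟩ := hR 0 (by simp)
      simp at h1 h2
      subst h1 h2
      refine Relation.ReflTransGen.head h3 (ih e (by simpa using hl) ?_)
      intro i hi
      simpa using hR (i + 1) (by simpa using hi)

end OracleSemidec

end Oracle

/-! ## Subwords -/

section Words

variable {k : ℕ} {α β : Type*} [Primcodable α] [Primcodable β]

theorem iota_eq_cons (w : Word k) : ∃ z, iota w = 1 :: 1 :: 0 :: z := by
  cases w <;> simp [iota]

theorem iota_injective : Function.Injective (iota : Word k → Word k) := fun a b h =>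
  (iota_append_inj (s := []) (t := []) (by simpa using h)).1

/-- The pattern `110` cannot begin in `0a₁…0aₙ011`: an even position of the body holds `0`, an odd
one is followed by `0`, and starting in the final `11` would force the continuation `r` to begin
with `0` or with `10`. -/
theorem subword_after_body {u s t r : Word k}
    (h : s ++ 1 :: 1 :: 0 :: t = u.flatMap (fun a => [0, a]) ++ 0 :: 1 :: 1 :: r)
    (h0 : ∀ r', r ≠ 0 :: r') (h1 : ∀ r', r ≠ 1 :: 0 :: r') :
    ∃ s', r = s' ++ 1 :: 1 :: 0 :: t := by
  induction u generalizing s with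
  | nil =>
    match s with
    | [] => simp at h
    | [a] =>
      simp at h
      exact absurd h.2.symm (h0 _)
    | [a, b] =>
      simp at h
      exact absurd h.2.2.symm (h1 _)
    | a :: b :: c :: s =>
      simp at h
      exact ⟨s, h.2.2.2.symm⟩
  | cons a u ih =>
    match s with
    | [] => simp at h
    | [b] =>
      exfalso
      cases u <;> simp at h
    | b :: c :: s =>
      simp only [List.flatMap_cons, List.cons_append, List.nil_append, List.cons.injEq] at h
      exact ih h.2.2

/-- In a concatenation of the words `ι(u)` and of the word `1`, the words of the form `ι(w)`
occur only as blocks. -/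
theorem mem_of_append_iota_append {l : List (Word k)} (hl : ∀ b ∈ l, b = [1] ∨ ∃ u, b = iota u)
    {w s t : Word k} (h : s ++ (iota w ++ t) = l.flatten) : iota w ∈ l := by
  -- Every block begins with `1`, and a filler `1` is followed by another `1`: these are the two
  -- side conditions of `subword_after_body`.
  have hhead : ∀ l : List (Word k), (∀ b ∈ l, b = [1] ∨ ∃ u, b = iota u) →
      ∀ r, l.flatten ≠ 0 :: r := by
    intro l hl r hr
    cases l with
    | nil => simp at hr
    | cons b l =>
      rcases hl b (by simp) with rfl | ⟨u, rfl⟩ <;> simp [iota] at hr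
  have hhead' : ∀ l : List (Word k), (∀ b ∈ l, b = [1] ∨ ∃ u, b = iota u) →
      ∀ r, l.flatten ≠ 1 :: 0 :: r := by
    intro l hl r hr
    cases l with
    | nil => simp at hr
    | cons b l =>
      rcases hl b (by simp) with rfl | ⟨u, rfl⟩
      · simp only [List.flatten_cons, List.cons_append, List.nil_append, List.cons.injEq,
          true_and] at hr
        exact hhead l (fun b hb => hl b (by simp [hb])) r hr
      · simp [iota] at hr
  induction l generalizing s with
  | nil => simp [iota] at h
  | cons b l ih =>
    have hl' : ∀ b ∈ l, b = [1] ∨ ∃ u, b = iota u := fun b hb => hl b (by simp [hb])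
    have hb := hl b (by simp)
    obtain ⟨z, hz⟩ := iota_eq_cons w
    match s, hb with
    | [], .inl hb =>
      subst hb
      simp only [hz, List.nil_append, List.flatten_cons, List.cons_append, List.cons.injEq,
        true_and] at h
      exact absurd h.symm (hhead' l hl' _)
    | a :: s, .inl hb =>
      subst hb
      simp only [List.flatten_cons, List.cons_append, List.nil_append, List.cons.injEq] at h
      exact List.mem_cons_of_mem _ (ih hl' h.2)
    | [], .inr ⟨u, hu⟩ =>
      subst hu
      rw [(iota_append_inj h).1]
      exact List.mem_cons_self
    | [a], .inr ⟨u, hu⟩ =>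
      subst hu
      exfalso
      cases u <;> simp [iota] at h
    | a :: c :: s, .inr ⟨u, hu⟩ =>
      subst hu
      have h2 : s ++ 1 :: 1 :: 0 :: (z ++ t)
          = u.flatMap (fun a => [0, a]) ++ 0 :: 1 :: 1 :: l.flatten := by
        have h' := h
        rw [hz] at h'
        simp only [iota, List.flatten_cons, List.cons_append, List.nil_append, List.append_assoc,
          List.cons.injEq] at h'
        exact h'.2.2
      obtain ⟨s', hs'⟩ := subword_after_body h2 (hhead l hl') (hhead' l hl')
      refine List.mem_cons_of_mem _ (ih (s := s') hl' ?_)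
      rw [hs', hz]
      rfl

theorem inWord_tuple {a : Word k} {us : List (Word k)} : InWord a (tuple us) ↔ a ∈ us := by
  have htuple : tuple us = (us.map iota).flatten := by rw [tuple, List.flatMap_def]
  constructor
  · rintro ⟨s, t, h⟩
    have h' : s ++ (iota a ++ t) = (us.map iota).flatten := by
      rw [← List.append_assoc, h, htuple]
    have := mem_of_append_iota_append (by
      intro b hb
      obtain ⟨u, -, rfl⟩ := List.mem_map.1 hb
      exact Or.inr ⟨u, rfl⟩) h'
    obtain ⟨u, hu, hua⟩ := List.mem_map.1 this
    rwa [← iota_injective hua]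
  · intro h
    obtain ⟨l, r, rfl⟩ := List.append_of_mem h
    exact ⟨tuple l, tuple r, by simp [tuple]⟩

theorem getElem?_flatMap_pair (u r : Word k) {j : ℕ} (hj : j < u.length) :
    (u.flatMap (fun a => [0, a]) ++ r)[2 * j + 1]? = u[j]? := by
  induction u generalizing j with
  | nil => simp at hj
  | cons a u ih =>
    cases j with
    | zero => simp
    | succ j =>
      have := ih (j := j) (by simpa using hj)
      rw [show 2 * (j + 1) + 1 = (2 * j + 1) + 1 + 1 by ring]
      simpa using this

theorem length_iota (w : Word k) : (iota w).length = 2 * w.length + 5 := by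
  have : (w.flatMap (fun a => [0, a])).length = 2 * w.length := by
    induction w with
    | nil => rfl
    | cons a w ih => simp [ih, Nat.mul_succ]
  simp [iota, this]

/-- The words `a` such that `ι(a)` is a subword of `w`. -/
def subwords (w : Word k) : List (Word k) :=
  -- In a copy of `ι(a)` that starts at `s`, the `j`-th letter of `a` stands at `s + 3 + 2 * j`.
  -- Wrong candidates are removed by the filter.
  ((List.range (w.length + 1)).flatMap fun s => (List.range (w.length + 1)).map fun l =>
      (List.range l).map fun j => (w[s + 3 + 2 * j]?).getD 0).filter
    fun a => (List.range (w.length + 1)).any fun n =>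
      (List.range (iota a).length).all fun i => decide (w[n + i]? = (iota a)[i]?)

theorem infix_iff_getElem? {v w : Word k} :
    v <:+: w ↔ ∃ n < w.length + 1, ∀ i < v.length, w[n + i]? = v[i]? := by
  constructor
  · rintro ⟨s, t, rfl⟩
    refine ⟨s.length, by simp, fun i hi => ?_⟩
    rw [List.append_assoc, List.getElem?_append_right (by omega), Nat.add_sub_cancel_left,
      List.getElem?_append_left hi]
  · rintro ⟨n, -, h⟩
    have : (w.drop n).take v.length = v := by
      apply List.ext_getElem?
      intro i
      by_cases hi : i < v.length
      · rw [List.getElem?_take, if_pos hi, List.getElem?_drop, h i hi]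
      · rw [List.getElem?_take, if_neg hi, List.getElem?_eq_none (by omega)]
    rw [← this]
    exact (List.take_prefix _ _).isInfix.trans (List.drop_suffix _ _).isInfix

theorem mem_subwords {a w : Word k} : a ∈ subwords w ↔ InWord a w := by
  have hb : (((List.range (w.length + 1)).any fun n =>
      (List.range (iota a).length).all fun i => decide (w[n + i]? = (iota a)[i]?)) = true)
      ↔ InWord a w := by
    rw [InWord, infix_iff_getElem?]
    simp only [List.any_eq_true, List.mem_range, List.all_eq_true, decide_eq_true_eq]
  rw [subwords, List.mem_filter, hb]
  refine ⟨fun h => h.2, fun h => ⟨?_, h⟩⟩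
  obtain ⟨n, hn, hi⟩ := infix_iff_getElem?.1 h
  have hlen : (iota a).length ≤ w.length := List.IsInfix.length_le h
  rw [length_iota] at hlen hi
  simp only [List.mem_flatMap, List.mem_range, List.mem_map]
  refine ⟨n, hn, a.length, by omega, ?_⟩
  apply List.ext_getElem?
  intro j
  by_cases hj : j < a.length
  · have h1 := hi (3 + 2 * j) (by omega)
    have h2 : (iota a)[3 + 2 * j]? = a[j]? := by
      rw [iota, show 3 + 2 * j = (2 * j + 1) + 1 + 1 by ring]
      simpa using getElem?_flatMap_pair a [0, 1, 1] hj
    have h3 : w[n + 3 + 2 * j]? = a[j]? := by rw [← h2, ← h1, Nat.add_assoc]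
    simp [hj, h3]
  · simp [hj]

@[fun_prop]
theorem primrec_iota {f : α → Word k} (hf : Primrec f) : Primrec fun a => iota (f a) := by
  unfold iota
  fun_prop

@[fun_prop]
theorem primrec_tuple {f : α → List (Word k)} (hf : Primrec f) :
    Primrec fun a => tuple (f a) := by
  unfold tuple
  fun_prop

@[fun_prop]
theorem primrec_unary {f : α → ℕ} (hf : Primrec f) :
    Primrec fun a => (unary (f a) : Word k) := by
  have : Primrec fun a => (List.range (f a)).map fun _ => (0 : Letter k) := by fun_prop
  exact this.of_eq fun a => by simp [unary, List.map_const']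

@[fun_prop]
theorem primrec_subwords {f : α → Word k} (hf : Primrec f) :
    Primrec fun a => subwords (f a) := by
  unfold subwords
  fun_prop

/-- `w ≪ p` is semidecidable in `w` if the symbols of `p` can be semidecided. -/
theorem OracleSemidec.inSeq {p : α → (ℕ → β) → OmegaWord k} {f : α → Word k} (hf : Primrec f)
    (h : OracleSemidec fun (q : α × ℕ × Letter k) y => p q.1 y q.2.1 = q.2.2) :
    OracleSemidec fun a y => InSeq (f a) (p a y) := by
  have key : OracleSemidec fun a y => ∃ n : ℕ, ∀ i < (iota (f a)).length,
      ∃ c : Letter k, (iota (f a))[i]? = some c ∧ p a y (n + i) = c := by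
    refine ex (all_lt (by fun_prop) (ex (and (eq (by fun_prop) (by fun_prop)) ?_)))
    exact comp (f := fun q : ((α × ℕ) × ℕ) × Letter k => (q.1.1.1, q.1.1.2 + q.1.2, q.2)) h
      (by fun_prop)
  refine key.of_iff fun a y => ?_
  unfold InSeq
  refine exists_congr fun n => forall₂_congr fun i hi => ?_
  simp [List.getElem?_eq_getElem hi, eq_comm]

end Words

/-! ## Enumerating machines -/

namespace Type2Machine

variable {k m : ℕ}

/-- The block that an enumerating machine writes after reading `h`. -/
def block (Q : Word k × List (Fin m → Option (Letter k)) → Bool)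
    (h : List (Fin m → Option (Letter k))) : Word k :=
  -- The code of each word is the first component of infinitely many lengths, so each word is tested
  -- on arbitrarily long prefixes. The block `[1]` is a filler.
  (Encodable.decode h.length.unpair.1 : Option (Word k)).elim [1]
    fun w => bif Q (w, h) then iota w else [1]

/-- The concatenation of the blocks that belong to the prefixes of `h`. -/
def blocks (Q : Word k × List (Fin m → Option (Letter k)) → Bool)
    (h : List (Fin m → Option (Letter k))) : Word k :=
  (List.range (h.length + 1)).flatMap fun j => block Q (h.take j)

/-- The symbol that an enumerating machine writes after reading `h`. -/
def nextSymbol (Q : Word k × List (Fin m → Option (Letter k)) → Bool)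
    (h : List (Fin m → Option (Letter k))) : Letter k := ((blocks Q h)[h.length]?).getD 1

theorem primrec_nextSymbol {Q : Word k × List (Fin m → Option (Letter k)) → Bool}
    (hQ : Primrec Q) : Primrec (nextSymbol Q) := by
  have h1 : Primrec (block Q) := by
    have h0 : Primrec fun h : List (Fin m → Option (Letter k)) => h.length.unpair.1 :=
      Primrec.fst.comp (Primrec.unpair.comp Primrec.list_length)
    unfold block
    fun_prop
  have h2 : Primrec (blocks Q) := by
    unfold blocks
    fun_prop
  unfold nextSymbol
  fun_prop

/-- The machine that lists the words that are accepted, with the prefixes of the input, by `Q`. -/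
def enumerator (Q : Word k × List (Fin m → Option (Letter k)) → Bool) (hQ : Primrec Q) :
    Type2Machine k m where
  Mem := List (Fin m → Option (Letter k))
  start := []
  -- All heads advance in every step and one symbol is written, so after `t` steps the storage is
  -- the first `t` columns of the input and the output has length `t`.
  step h s := (h ++ [s], fun _ => true, some (nextSymbol Q h))
  step_computable := by
    have h1 := primrec_nextSymbol hQ
    have : Primrec fun p : List (Fin m → Option (Letter k)) × (Fin m → Option (Letter k)) =>
        (p.1 ++ [p.2], (fun _ => true : Fin m → Bool), some (nextSymbol Q p.1)) := by
      refine Primrec.pair (by fun_prop) (Primrec.pair (Primrec.const _) ?_)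
      fun_prop
    exact this.to_comp

variable {Q : Word k × List (Fin m → Option (Letter k)) → Bool}

/-- The output of the enumerating machine. -/
def enumeration (Q : Word k × List (Fin m → Option (Letter k)) → Bool)
    (x : ℕ → Fin m → Option (Letter k)) : OmegaWord k := fun n => nextSymbol Q (history x n)

theorem config_enumerator (hQ : Primrec Q) (y : Fin m → InTape k) (t : ℕ) :
    (enumerator Q hQ).config y t = ⟨history (fun t i => y i t) t, fun _ => t,
      history (enumeration Q fun t i => y i t) t⟩ := by
  induction t with
  | zero => rfl
  | succ t ih =>
    rw [config, ih, history_succ, history_succ]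
    rfl

theorem computes_enumerator (hQ : Primrec Q) {y : Fin m → InTape k} {q : OmegaWord k} :
    (enumerator Q hQ).Computes y q ↔ q = enumeration Q fun t i => y i t := by
  unfold Computes
  simp only [config_enumerator]
  constructor
  · intro h
    funext n
    obtain ⟨t, ht⟩ := h n
    by_cases hn : n < t
    · simpa [history, hn, eq_comm] using ht
    · simp [history, hn] at ht
  · rintro rfl n
    exact ⟨n + 1, by simp [history]⟩

theorem block_cases (h : List (Fin m → Option (Letter k))) :
    block Q h = [1] ∨ ∃ w, block Q h = iota w ∧ Q (w, h) := by
  unfold block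
  cases (Encodable.decode h.length.unpair.1 : Option (Word k)) with
  | none => exact Or.inl rfl
  | some w =>
    cases hQ : Q (w, h)
    · simp [hQ]
    · exact Or.inr ⟨w, by simp [hQ], hQ⟩

theorem blocks_history (x : ℕ → Fin m → Option (Letter k)) (n : ℕ) :
    blocks Q (history x n) = ((List.range (n + 1)).map fun j => block Q (history x j)).flatten := by
  rw [blocks, List.flatMap_def, length_history]
  congr 1
  refine List.map_congr_left fun j hj => ?_
  rw [history_take x (by simpa [Nat.lt_succ_iff] using hj)]

theorem blocks_succ (x : ℕ → Fin m → Option (Letter k)) (n : ℕ) :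
    blocks Q (history x (n + 1)) = blocks Q (history x n) ++ block Q (history x (n + 1)) := by
  rw [blocks_history, blocks_history, List.range_succ (n := n + 1)]
  simp

theorem blocks_prefix (x : ℕ → Fin m → Option (Letter k)) {n n' : ℕ} (h : n ≤ n') :
    blocks Q (history x n) <+: blocks Q (history x n') := by
  induction h with
  | refl => exact List.prefix_refl _
  | step _ ih => exact ih.trans (by rw [blocks_succ]; exact List.prefix_append _ _)

/-- No block is empty, so the symbol due at time `n` is determined by the input read so far, and the
default value in `nextSymbol` is never taken. -/
theorem lt_length_blocks (x : ℕ → Fin m → Option (Letter k)) (n : ℕ) :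
    n < (blocks Q (history x n)).length := by
  have hb : ∀ j, 0 < (block Q (history x j)).length := by
    intro j
    rcases block_cases (Q := Q) (history x j) with h | ⟨w, h, -⟩
    · simp [h]
    · rw [h, length_iota]
      omega
  induction n with
  | zero =>
    rw [blocks_history]
    simpa using hb 0
  | succ n ih =>
    rw [blocks_succ, List.length_append]
    have := hb (n + 1)
    omega

theorem getElem?_blocks (x : ℕ → Fin m → Option (Letter k)) {n t : ℕ}
    (h : t < (blocks Q (history x n)).length) :
    (blocks Q (history x n))[t]? = some (enumeration Q x t) := by
  have h1 : (blocks Q (history x t))[t]? = some (enumeration Q x t) := by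
    rw [enumeration, nextSymbol, length_history, List.getElem?_eq_getElem (lt_length_blocks x t)]
    rfl
  rcases le_total n t with hnt | hnt
  · obtain ⟨r, hr⟩ := blocks_prefix (Q := Q) x hnt
    rw [← h1, ← hr, List.getElem?_append_left h]
  · obtain ⟨r, hr⟩ := blocks_prefix (Q := Q) x hnt
    rw [← h1, ← hr, List.getElem?_append_left (lt_length_blocks x t)]

theorem inSeq_enumeration {x : ℕ → Fin m → Option (Letter k)}
    (hmono : ∀ w l l', l <+: l' → Q (w, l) → Q (w, l')) {w : Word k} :
    InSeq w (enumeration Q x) ↔ ∃ n, Q (w, history x n) := by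
  constructor
  · rintro ⟨n, hn⟩
    have hinf : iota w <:+: blocks Q (history x (n + (iota w).length)) := by
      rw [infix_iff_getElem?]
      have hlt := lt_length_blocks (Q := Q) x (n + (iota w).length)
      refine ⟨n, by omega, fun i hi => ?_⟩
      rw [getElem?_blocks x (by omega), hn i hi, List.getElem?_eq_getElem hi]
    obtain ⟨s, t, hst⟩ := hinf
    rw [blocks_history, List.append_assoc] at hst
    have hmem := mem_of_append_iota_append (by
      intro b hb
      obtain ⟨j, -, rfl⟩ := List.mem_map.1 hb
      rcases block_cases (Q := Q) (history x j) with h | ⟨w, h, -⟩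
      · exact Or.inl h
      · exact Or.inr ⟨w, h⟩) hst
    obtain ⟨j, -, hj⟩ := List.mem_map.1 hmem
    rcases block_cases (Q := Q) (history x j) with h | ⟨w', h, hQ⟩
    · rw [h] at hj
      simp [iota] at hj
    · rw [h] at hj
      rw [← iota_injective hj]
      exact ⟨j, hQ⟩
  · rintro ⟨n, hn⟩
    -- At this length the word `w` has its turn, and the prefix is at least as long as the accepted
    -- one.
    have hQ : Q (w, history x (Nat.pair (Encodable.encode w) n)) :=
      hmono _ _ _ (history_prefix x (Nat.right_le_pair _ _)) hn
    have hb : block Q (history x (Nat.pair (Encodable.encode w) n)) = iota w := by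
      simp [block, hQ]
    obtain ⟨s, hs⟩ : ∃ s, blocks Q (history x (Nat.pair (Encodable.encode w) n))
        = s ++ iota w := by
      rw [blocks_history, List.range_succ]
      simp [hb]
    refine ⟨s.length, fun i hi => ?_⟩
    have := getElem?_blocks (Q := Q) x (n := Nat.pair (Encodable.encode w) n) (t := s.length + i)
      (by rw [hs, List.length_append]; omega)
    rw [hs, List.getElem?_append_right (by omega), Nat.add_sub_cancel_left,
      List.getElem?_eq_getElem hi] at this
    exact (Option.some.inj this).symm

/-- Every set of words that is semidecidable relative to the input is listed by a machine. -/
theorem exists_enumerator {P : Word k → (ℕ → Fin m → Option (Letter k)) → Prop}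
    (hP : OracleSemidec P) : ∃ (M : Type2Machine k m)
      (E : (ℕ → Fin m → Option (Letter k)) → OmegaWord k),
      (∀ y q, M.Computes y q ↔ q = E fun t i => y i t) ∧ ∀ x w, InSeq w (E x) ↔ P w x := by
  obtain ⟨Q, hQ, hmono, h⟩ := hP
  refine ⟨enumerator Q hQ, enumeration Q, fun y q => computes_enumerator hQ, fun x w => ?_⟩
  rw [inSeq_enumeration hmono, h]

end Type2Machine

theorem exists_seqComputable {k : ℕ} {P : Word k → (ℕ → Fin 1 → Option (Letter k)) → Prop}
    (hP : OracleSemidec P) : ∃ g : OmegaWord k →. OmegaWord k, SeqComputable g ∧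
      ∀ p, ∃ q ∈ g p, ∀ w, InSeq w q ↔ P w fun t _ => some (p t) := by
  obtain ⟨M, E, hM, hE⟩ := Type2Machine.exists_enumerator hP
  refine ⟨fun p => Part.some (E fun t _ => some (p t)), ⟨M, fun p q => ?_⟩,
    fun p => ⟨_, Part.mem_some _, fun w => hE _ w⟩⟩
  rw [hM, Part.mem_some_iff]
  have : (fun t i => (![seqTape p] : Fin 1 → InTape k) i t) = fun t _ => some (p t) := by
    funext t i
    fin_cases i
    rfl
  rw [this]

theorem exists_wordSeqComputable {k : ℕ} {P : Word k → (ℕ → Fin 2 → Option (Letter k)) → Prop}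
    (hP : OracleSemidec P) : ∃ f : Word k → OmegaWord k →. OmegaWord k, WordSeqComputable f ∧
      ∀ u p, ∃ q ∈ f u p, ∀ w, InSeq w q ↔ P w fun t => ![u[t]?, some (p t)] := by
  obtain ⟨M, E, hM, hE⟩ := Type2Machine.exists_enumerator hP
  refine ⟨fun u p => Part.some (E fun t => ![u[t]?, some (p t)]), ⟨M, fun u p q => ?_⟩,
    fun u p => ⟨_, Part.mem_some _, fun w => hE _ w⟩⟩
  rw [hM, Part.mem_some_iff]
  have : (fun t i => (![wordTape u, seqTape p] : Fin 2 → InTape k) i t)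
      = fun t => ![u[t]?, some (p t)] := by
    funext t i
    fin_cases i <;> rfl
  rw [this]

/-! ## Covers of products, in terms of the names of the basic neighbourhoods -/

section Covers

variable {k : ℕ}

/-- `E` consists of the words `w` such that all `a ≪ w` are in `D` and such that every member of
`𝒦` contains some `a ≪ w`. -/
def IsCoverName (D : Set (Word k)) (𝒦 : Set (Set (Word k))) (E : Word k → Prop) : Prop :=
  ∀ w, E w ↔ (∀ a, InWord a w → a ∈ D) ∧ ∀ T ∈ 𝒦, ∃ a, InWord a w ∧ a ∈ T

/-- The properties of the neighbourhood traces `𝒦` of the points of a compact set that make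
covers of products effective; `Sub c a` is a formal inclusion of basic sets. -/
structure IsCompactTrace (D : Set (Word k)) (𝒦 : Set (Set (Word k)))
    (Sub : Word k → Word k → Prop) : Prop where
  subset : ∀ T ∈ 𝒦, T ⊆ D
  mem_of_sub : ∀ T ∈ 𝒦, ∀ c ∈ T, ∀ a, Sub c a → a ∈ T
  exists_sub : ∀ T ∈ 𝒦, ∀ l : List (Word k), (∀ a ∈ l, a ∈ T) → ∃ c ∈ T, ∀ a ∈ l, Sub c a
  exists_finite : ∀ f : Set (Word k) → Word k, (∀ T ∈ 𝒦, f T ∈ T) →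
    ∃ l : List (Word k), (∀ c ∈ l, ∃ T ∈ 𝒦, f T = c) ∧ ∀ T ∈ 𝒦, ∃ c ∈ l, c ∈ T

/-- The words that denote a list of words of which the `i`-th one is in `A i`. -/
def box (Dec : Word k → List (Word k) → Prop) (A : ℕ → Set (Word k)) : Set (Word k) :=
  {v | ∃ us, Dec v us ∧ ∀ i a, us[i]? = some a → a ∈ A i}

/-- The boxes with sides in `𝒦 i`. -/
def boxes (Dec : Word k → List (Word k) → Prop) (𝒦 : ℕ → Set (Set (Word k))) :
    Set (Set (Word k)) :=
  {B | ∃ T : ℕ → Set (Word k), (∀ i, T i ∈ 𝒦 i) ∧ B = box Dec T}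

/-- The condition by which covers of a product are recognized from covers of the factors. -/
def ProductCover (Dec : Word k → List (Word k) → Prop) (E : ℕ → Word k → Prop)
    (Sub : ℕ → Word k → Word k → Prop) (w : Word k) : Prop :=
  (∀ v, InWord v w → v ∈ box Dec fun i => {a | ∃ u, E i u ∧ InWord a u}) ∧
  ∃ W : List (Word k), (∀ i u, W[i]? = some u → E i u) ∧
    ∀ cs, List.Forall₂ InWord cs W → ∃ v, InWord v w ∧ ∃ us, Dec v us ∧
      ∀ i a, us[i]? = some a → ∃ c, cs[i]? = some c ∧ Sub i c a

theorem box_congr {Dec : Word k → List (Word k) → Prop} {A B : ℕ → Set (Word k)}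
    (h : ∀ v us, Dec v us → ∀ i < us.length, A i = B i) : box Dec A = box Dec B := by
  ext v
  refine exists_congr fun us => and_congr_right fun hd => forall_congr' fun i =>
    forall₂_congr fun a ha => ?_
  rw [h v us hd i (List.getElem?_eq_some_iff.1 ha).1]

/-- A word of the right-hand box provides traces only for the entries that it decodes to; the
coordinates beyond its length must be filled with arbitrary traces, which therefore have to exist.
-/
theorem sUnion_boxes {Dec : Word k → List (Word k) → Prop} {𝒦 : ℕ → Set (Set (Word k))}
    (h : ∀ v us, Dec v us → ∀ i, us.length ≤ i → (𝒦 i).Nonempty) :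
    ⋃₀ boxes Dec 𝒦 = box Dec fun i => ⋃₀ 𝒦 i := by
  ext v
  constructor
  · rintro ⟨_, ⟨T, hT, rfl⟩, us, hd, hus⟩
    exact ⟨us, hd, fun i a ha => ⟨T i, hT i, hus i a ha⟩⟩
  · rintro ⟨us, hd, hus⟩
    have : ∀ i, ∃ T ∈ 𝒦 i, ∀ a, us[i]? = some a → a ∈ T := by
      intro i
      by_cases hi : i < us.length
      · obtain ⟨T, hT, ha⟩ := hus i _ (List.getElem?_eq_getElem hi)
        refine ⟨T, hT, fun a h => ?_⟩
        rw [List.getElem?_eq_getElem hi, Option.some.injEq] at h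
        rwa [← h]
      · obtain ⟨T, hT⟩ := h v us hd i (not_lt.1 hi)
        exact ⟨T, hT, fun a h => by simp [List.getElem?_eq_none (not_lt.1 hi)] at h⟩
    choose T hT hTus using this
    exact ⟨_, ⟨T, hT, rfl⟩, us, hd, hTus⟩

/-- Some finite cover exists by `exists_finite`, and adding `a ∈ D` to it gives another listed
cover. -/
theorem IsCoverName.exists_inWord_iff {D : Set (Word k)} {𝒦 : Set (Set (Word k))}
    {E : Word k → Prop} {Sub : Word k → Word k → Prop} (hE : IsCoverName D 𝒦 E)
    (h𝒦 : IsCompactTrace D 𝒦 Sub) {a : Word k} : (∃ u, E u ∧ InWord a u) ↔ a ∈ D := by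
  constructor
  · rintro ⟨u, hu, hau⟩
    exact ((hE u).1 hu).1 a hau
  · intro ha
    have : ∀ T, ∃ c, T ∈ 𝒦 → c ∈ T := by
      intro T
      by_cases hT : T ∈ 𝒦
      · obtain ⟨c, hc, -⟩ := h𝒦.exists_sub T hT [] (by simp)
        exact ⟨c, fun _ => hc⟩
      · exact ⟨[], fun h => absurd h hT⟩
    choose f hf using this
    obtain ⟨l, hl, hcov⟩ := h𝒦.exists_finite f hf
    refine ⟨tuple (a :: l), (hE _).2 ⟨fun b hb => ?_, fun T hT => ?_⟩, inWord_tuple.2 (by simp)⟩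
    · rcases List.mem_cons.1 (inWord_tuple.1 hb) with rfl | hb
      · exact ha
      · obtain ⟨T, hT, rfl⟩ := hl b hb
        exact h𝒦.subset T hT (hf T hT)
    · obtain ⟨c, hc, hcT⟩ := hcov T hT
      exact ⟨c, inWord_tuple.2 (by simp [hc]), hcT⟩

/-- The second clause says that every index below `N` is really used by some list. It keeps the
covers chosen later inside the index set of the factors. -/
theorem exists_max_length {α : Type*} (L : List (List α)) :
    ∃ N, (∀ l ∈ L, l.length ≤ N) ∧ ∀ i < N, ∃ l ∈ L, i < l.length := by
  induction L with
  | nil => exact ⟨0, by simp, by simp⟩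
  | cons l L ih =>
    obtain ⟨N, h1, h2⟩ := ih
    refine ⟨max l.length N, ?_, fun i hi => ?_⟩
    · intro m hm
      rcases List.mem_cons.1 hm with rfl | hm
      · exact le_max_left _ _
      · exact (h1 m hm).trans (le_max_right _ _)
    · rcases lt_max_iff.1 hi with hi | hi
      · exact ⟨l, by simp, hi⟩
      · obtain ⟨m, hm, him⟩ := h2 i hi
        exact ⟨m, by simp [hm], him⟩

/-! ### Soundness and completeness of the criterion for product covers -/

section

variable {Dec : Word k → List (Word k) → Prop} {E : ℕ → Word k → Prop}
  {Sub : ℕ → Word k → Word k → Prop} {D : ℕ → Set (Word k)} {𝒦 : ℕ → Set (Set (Word k))}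
  {I : Set ℕ}

/-- Each listed cover has a member in the given trace `T i`. The box found for this choice contains
the point, because formal inclusion preserves membership in a trace. -/
theorem exists_mem_box_of_choices (hE : ∀ i ∈ I, IsCoverName (D i) (𝒦 i) (E i))
    (hE' : ∀ i ∉ I, ∀ w, ¬ E i w) (h𝒦 : ∀ i ∈ I, IsCompactTrace (D i) (𝒦 i) (Sub i))
    (hdec : ∀ v us, Dec v us → ∀ i < us.length, i ∈ I) {w : Word k} {W : List (Word k)}
    (hW : ∀ i u, W[i]? = some u → E i u)
    (hcs : ∀ cs, List.Forall₂ InWord cs W → ∃ v, InWord v w ∧ ∃ us, Dec v us ∧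
      ∀ i a, us[i]? = some a → ∃ c, cs[i]? = some c ∧ Sub i c a)
    {T : ℕ → Set (Word k)} (hT : ∀ i, T i ∈ 𝒦 i) : ∃ v, InWord v w ∧ v ∈ box Dec T := by
  have : ∀ i, ∃ c, ∀ u, W[i]? = some u → InWord c u ∧ c ∈ T i := by
    intro i
    cases hu : W[i]? with
    | none => exact ⟨[], by simp⟩
    | some u =>
      have hEu := hW i u hu
      have hi : i ∈ I := by
        by_contra hi
        exact hE' i hi u hEu
      obtain ⟨c, hc, hcT⟩ := ((hE i hi u).1 hEu).2 _ (hT i)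
      refine ⟨c, fun u' hu' => ?_⟩
      rw [← Option.some.inj hu']
      exact ⟨hc, hcT⟩
  choose c hc using this
  obtain ⟨v, hv, us, hd, hus⟩ := hcs ((List.range W.length).map c) (by
    rw [List.forall₂_iff_get]
    refine ⟨by simp, fun i h1 h2 => ?_⟩
    simpa using (hc i _ (List.getElem?_eq_getElem h2)).1)
  refine ⟨v, hv, us, hd, fun i a ha => ?_⟩
  obtain ⟨c', hc', hsub⟩ := hus i a ha
  have hi := hdec v us hd i (List.getElem?_eq_some_iff.1 ha).1
  by_cases hlt : i < W.length
  · have : c i = c' := by simpa [hlt] using hc'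
    subst this
    exact (h𝒦 i hi).mem_of_sub _ (hT i) _ (hc i _ (List.getElem?_eq_getElem hlt)).2 _ hsub
  · simp [hlt] at hc'

/-- The neighbourhoods are refined relative to the finitely many sides that occur in `w` before
compactness of each factor is applied, so that membership of a point in a side becomes formal
inclusion. -/
theorem exists_choices_of_mem_box (hE : ∀ i ∈ I, IsCoverName (D i) (𝒦 i) (E i))
    (h𝒦 : ∀ i ∈ I, IsCompactTrace (D i) (𝒦 i) (Sub i)) (h𝒦' : ∀ i ∉ I, (𝒦 i).Nonempty)
    (hI : ∀ i ∈ I, ∀ j ≤ i, j ∈ I) (hdec : ∀ v us, Dec v us → ∀ i < us.length, i ∈ I)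
    (hdec' : ∀ v us us', Dec v us → Dec v us' → us = us') {w : Word k}
    (hbox : ∀ T : ℕ → Set (Word k), (∀ i, T i ∈ 𝒦 i) → ∃ v, InWord v w ∧ v ∈ box Dec T) :
    ∃ W : List (Word k), (∀ i u, W[i]? = some u → E i u) ∧
      ∀ cs, List.Forall₂ InWord cs W → ∃ v, InWord v w ∧ ∃ us, Dec v us ∧
        ∀ i a, us[i]? = some a → ∃ c, cs[i]? = some c ∧ Sub i c a := by
  classical
  have hL : ∃ L : List (List (Word k)), (∀ us ∈ L, ∃ v, Dec v us) ∧
      ∀ v us, InWord v w → Dec v us → us ∈ L := by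
    refine ⟨(subwords w).filterMap fun v => if h : ∃ us, Dec v us then some h.choose else none,
      ?_, ?_⟩
    · intro us hus
      obtain ⟨v, -, hv⟩ := List.mem_filterMap.1 hus
      by_cases h : ∃ us, Dec v us
      · rw [dif_pos h, Option.some.injEq] at hv
        exact ⟨v, hv ▸ h.choose_spec⟩
      · simp [h] at hv
    · intro v us hv hd
      refine List.mem_filterMap.2 ⟨v, mem_subwords.2 hv, ?_⟩
      have h : ∃ us, Dec v us := ⟨us, hd⟩
      rw [dif_pos h, hdec' v _ _ h.choose_spec hd]
  obtain ⟨L, hL1, hL2⟩ := hL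
  -- For the trace `T` of a point, `c` is a neighbourhood of that point formally below all `i`-th
  -- sides in `w` that contain it.
  have hf : ∀ i T, ∃ c, i ∈ I → T ∈ 𝒦 i → c ∈ T ∧
      ∀ us ∈ L, ∀ a, us[i]? = some a → a ∈ T → Sub i c a := by
    intro i T
    by_cases h : i ∈ I ∧ T ∈ 𝒦 i
    · obtain ⟨c, hc, hsub⟩ := (h𝒦 i h.1).exists_sub T h.2
        ((L.filterMap fun us => us[i]?).filter (· ∈ T)) (by simp)
      refine ⟨c, fun _ _ => ⟨hc, fun us hus a ha haT => hsub a ?_⟩⟩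
      exact List.mem_filter.2 ⟨List.mem_filterMap.2 ⟨us, hus, ha⟩, by simpa using haT⟩
    · exact ⟨[], fun h1 h2 => absurd ⟨h1, h2⟩ h⟩
  choose f hf using hf
  have hcs : ∀ i, ∃ l : List (Word k), i ∈ I →
      (∀ c ∈ l, ∃ T ∈ 𝒦 i, f i T = c) ∧ ∀ T ∈ 𝒦 i, ∃ c ∈ l, c ∈ T := by
    intro i
    by_cases hi : i ∈ I
    · obtain ⟨l, hl⟩ := (h𝒦 i hi).exists_finite (f i) fun T hT => (hf i T hi hT).1
      exact ⟨l, fun _ => hl⟩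
    · exact ⟨[], fun h => absurd h hi⟩
  choose l hl using hcs
  have hEl : ∀ N, (∀ i < N, i ∈ I) → ∀ i u,
      ((List.range N).map fun i => tuple (l i))[i]? = some u → E i u := by
    intro N hN i u hu
    by_cases hi : i < N
    · have hiI := hN i hi
      have : tuple (l i) = u := by simpa [hi] using hu
      subst this
      refine (hE i hiI _).2 ⟨fun a ha => ?_, fun T hT => ?_⟩
      · obtain ⟨T, hT, rfl⟩ := (hl i hiI).1 a (inWord_tuple.1 ha)
        exact (h𝒦 i hiI).subset T hT (hf i T hiI hT).1
      · obtain ⟨c, hc, hcT⟩ := (hl i hiI).2 T hT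
        exact ⟨c, inWord_tuple.2 hc, hcT⟩
    · simp [hi] at hu
  have hchoice : ∀ N cs, List.Forall₂ InWord cs ((List.range N).map fun i => tuple (l i)) →
      ∀ i < N, ∃ c ∈ l i, cs[i]? = some c := by
    intro N cs h i hi
    rw [List.forall₂_iff_get] at h
    have hlen : cs.length = N := by simpa using h.1
    have := h.2 i (by omega) (by simpa using hi)
    refine ⟨cs[i], ?_, List.getElem?_eq_getElem _⟩
    simpa [inWord_tuple] using this
  -- With no empty factor, covers are needed only for the `N` coordinates that occur in `w`.
  by_cases hne : ∀ i, (𝒦 i).Nonempty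
  · obtain ⟨N, hN1, hN2⟩ := exists_max_length L
    have hNI : ∀ i < N, i ∈ I := by
      intro i hi
      obtain ⟨us, hus, hlt⟩ := hN2 i hi
      obtain ⟨v, hd⟩ := hL1 us hus
      exact hdec v us hd i hlt
    refine ⟨_, hEl N hNI, fun cs h => ?_⟩
    -- The chosen members come from traces; with arbitrary traces beyond `N` they make up a point of
    -- the product, to which `hbox` applies.
    have hT : ∀ i, ∃ T ∈ 𝒦 i, i < N → cs[i]? = some (f i T) := by
      intro i
      by_cases hi : i < N
      · obtain ⟨c, hc, hcs⟩ := hchoice N cs h i hi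
        obtain ⟨T, hT, rfl⟩ := (hl i (hNI i hi)).1 c hc
        exact ⟨T, hT, fun _ => hcs⟩
      · obtain ⟨T, hT⟩ := hne i
        exact ⟨T, hT, fun h => absurd h hi⟩
    choose T hT hTcs using hT
    obtain ⟨v, hv, us, hd, hus⟩ := hbox T hT
    have husL := hL2 v us hv hd
    refine ⟨v, hv, us, hd, fun i a ha => ?_⟩
    have hi : i < N := (List.getElem?_eq_some_iff.1 ha).1.trans_le (hN1 us husL)
    exact ⟨_, hTcs i hi, (hf i (T i) (hNI i hi) (hT i)).2 us husL a ha (hus i a ha)⟩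
  · push Not at hne
    obtain ⟨j, hj⟩ := hne
    have hjI : j ∈ I := by
      by_contra h
      exact (h𝒦' j h).ne_empty hj
    -- The cover `l j` of the empty factor has no members, so there are no choices `cs`. The covers
    -- with smaller indices only put it at position `j`.
    refine ⟨_, hEl (j + 1) fun i hi => hI j hjI i (Nat.lt_succ_iff.1 hi), fun cs h => ?_⟩
    obtain ⟨c, hc, -⟩ := hchoice (j + 1) cs h j j.lt_succ_self
    obtain ⟨T, hT, -⟩ := (hl j hjI).1 c hc
    rw [hj] at hT
    exact absurd hT (Set.notMem_empty T)

/-- The words with the property `ProductCover` are a name of the product. -/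
theorem isCoverName_productCover (hE : ∀ i ∈ I, IsCoverName (D i) (𝒦 i) (E i))
    (hE' : ∀ i ∉ I, ∀ w, ¬ E i w) (h𝒦 : ∀ i ∈ I, IsCompactTrace (D i) (𝒦 i) (Sub i))
    (h𝒦' : ∀ i ∉ I, (𝒦 i).Nonempty)
    (hI : ∀ i ∈ I, ∀ j ≤ i, j ∈ I) (hdec : ∀ v us, Dec v us → ∀ i < us.length, i ∈ I)
    (hdec' : ∀ v us us', Dec v us → Dec v us' → us = us') :
    IsCoverName (box Dec D) (boxes Dec 𝒦) (ProductCover Dec E Sub) := by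
  intro w
  have hbox : (box Dec fun i => {a | ∃ u, E i u ∧ InWord a u}) = box Dec D := by
    refine box_congr fun v us hd i hi => ?_
    ext a
    exact (hE i (hdec v us hd i hi)).exists_inWord_iff (h𝒦 i (hdec v us hd i hi))
  unfold ProductCover
  rw [hbox]
  refine and_congr_right fun _ => ⟨?_, fun h => ?_⟩
  · rintro ⟨W, hW, hcs⟩ _ ⟨T, hT, rfl⟩
    exact exists_mem_box_of_choices hE hE' h𝒦 hdec hW hcs hT
  · exact exists_choices_of_mem_box hE h𝒦 h𝒦' hI hdec hdec' fun T hT => h _ ⟨T, hT, rfl⟩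

end

/-! ### Semidecidability -/

/-- The lists that choose some `a ≪ u` for every entry `u` of a list. -/
def choices (W : List (Word k)) : List (List (Word k)) :=
  W.foldr (fun u r => (subwords u).flatMap fun a => r.map fun cs => a :: cs) [[]]

theorem mem_choices {W cs : List (Word k)} : cs ∈ choices W ↔ List.Forall₂ InWord cs W := by
  induction W generalizing cs with
  | nil => simp [choices]
  | cons u W ih =>
    rw [choices, List.foldr_cons, ← choices]
    simp only [List.mem_flatMap, mem_subwords, List.mem_map, ih]
    constructor
    · rintro ⟨a, ha, cs, hcs, rfl⟩
      exact List.Forall₂.cons ha hcs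
    · rintro (_ | ⟨ha, hcs⟩)
      exact ⟨_, ha, _, hcs, rfl⟩

variable {α β : Type*} [Primcodable α] [Primcodable β]

@[fun_prop]
theorem primrec_choices {f : α → List (Word k)} (hf : Primrec f) :
    Primrec fun a => choices (f a) := by
  unfold choices
  fun_prop

theorem OracleSemidec.all_getElem? {γ : Type*} [Primcodable γ] [DecidableEq γ]
    {P : α → ℕ → γ → (ℕ → β) → Prop}
    {f : α → List γ} (hf : Primrec f)
    (h : OracleSemidec fun (p : (α × ℕ) × γ) y => P p.1.1 p.1.2 p.2 y) :
    OracleSemidec fun a y => ∀ i c, (f a)[i]? = some c → P a i c y := by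
  have key : OracleSemidec fun a y => ∀ i < (f a).length, ∃ c, (f a)[i]? = some c ∧ P a i c y :=
    all_lt (by fun_prop) (ex (and (eq (by fun_prop) (by fun_prop)) h))
  refine key.of_iff fun a y => ⟨fun H i hi => ⟨_, List.getElem?_eq_getElem hi,
    H i _ (List.getElem?_eq_getElem hi)⟩, fun H i c hc => ?_⟩
  obtain ⟨c', hc', hP⟩ := H i (List.getElem?_eq_some_iff.1 hc).1
  rw [hc, Option.some.injEq] at hc'
  rwa [hc']

theorem OracleSemidec.inWord {f g : α → Word k} (hf : Primrec f) (hg : Primrec g) :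
    OracleSemidec fun a (_ : ℕ → β) => InWord (f a) (g a) :=
  (of_primrec (f := fun a => (subwords (g a)).any fun b => decide (f a = b))
    (by fun_prop)).of_iff fun a y => by simp [mem_subwords]

theorem OracleSemidec.productCover {Dec : (ℕ → β) → Word k → List (Word k) → Prop}
    {E : (ℕ → β) → ℕ → Word k → Prop} {Sub : (ℕ → β) → ℕ → Word k → Word k → Prop}
    (hDec : OracleSemidec fun (p : Word k × List (Word k)) y => Dec y p.1 p.2)
    (hE : OracleSemidec fun (p : ℕ × Word k) y => E y p.1 p.2)
    (hSub : OracleSemidec fun (p : ℕ × Word k × Word k) y => Sub y p.1 p.2.1 p.2.2) :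
    OracleSemidec fun w y => ProductCover (Dec y) (E y) (Sub y) w := by
  have hit : OracleSemidec fun (p : ℕ × Word k) y => ∃ u, E y p.1 u ∧ InWord p.2 u :=
    ex (and (comp hE (f := fun q : (ℕ × Word k) × Word k => (q.1.1, q.2)) (by fun_prop))
      (OracleSemidec.inWord (by fun_prop) (by fun_prop)))
  have hbox : OracleSemidec fun (v : Word k) y => v ∈ box (Dec y) fun i =>
      {a | ∃ u, E y i u ∧ InWord a u} :=
    ex (and hDec (all_getElem? (by fun_prop)
      (comp hit (f := fun q : ((Word k × List (Word k)) × ℕ) × Word k => (q.1.2, q.2))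
        (by fun_prop))))
  have h1 : OracleSemidec fun (w : Word k) (y : ℕ → β) => ∀ v ∈ subwords w,
      v ∈ box (Dec y) fun i => {a | ∃ u, E y i u ∧ InWord a u} :=
    all_mem (by fun_prop) (comp hbox (f := fun p : Word k × Word k => p.2) (by fun_prop))
  have hnames : OracleSemidec fun (W : List (Word k)) y => ∀ i u, W[i]? = some u → E y i u :=
    all_getElem? (by fun_prop)
      (comp hE (f := fun p : (List (Word k) × ℕ) × Word k => (p.1.2, p.2)) (by fun_prop))
  have hsub : OracleSemidec fun (p : List (Word k) × List (Word k)) y =>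
      ∀ i a, p.2[i]? = some a → ∃ c, p.1[i]? = some c ∧ Sub y i c a :=
    all_getElem? (by fun_prop) (ex (and (eq (by fun_prop) (by fun_prop))
      (comp hSub (f := fun p : (((List (Word k) × List (Word k)) × ℕ) × Word k) × Word k =>
        (p.1.1.2, p.2, p.1.2)) (by fun_prop))))
  have hcov : OracleSemidec fun (p : Word k × List (Word k)) y => ∃ v, InWord v p.1 ∧
      ∃ us, Dec y v us ∧ ∀ i a, us[i]? = some a → ∃ c, p.2[i]? = some c ∧ Sub y i c a :=
    ex (and (OracleSemidec.inWord (by fun_prop) (by fun_prop)) (ex (and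
      (comp hDec (f := fun q : ((Word k × List (Word k)) × Word k) × List (Word k) =>
        (q.1.2, q.2)) (by fun_prop))
      (comp hsub (f := fun q : ((Word k × List (Word k)) × Word k) × List (Word k) =>
        (q.1.1.2, q.2)) (by fun_prop)))))
  have h2 : OracleSemidec fun (w : Word k) (y : ℕ → β) => ∃ W : List (Word k),
      (∀ i u, W[i]? = some u → E y i u) ∧ ∀ cs ∈ choices W, ∃ v, InWord v w ∧
        ∃ us : List (Word k), Dec y v us ∧
        ∀ i a, us[i]? = some a → ∃ c, cs[i]? = some c ∧ Sub y i c a :=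
    ex (and (comp hnames (f := fun p : Word k × List (Word k) => p.2) (by fun_prop))
      (all_mem (by fun_prop) (comp hcov
        (f := fun p : (Word k × List (Word k)) × List (Word k) => (p.1.1, p.2)) (by fun_prop))))
  refine (h1.and h2).of_iff fun w y => ?_
  unfold ProductCover
  simp only [mem_subwords, mem_choices]

end Covers

/-! ## Neighbourhood traces in effective topological spaces -/

section Traces

variable {k : ℕ}

/-- The formal inclusion that is generated by a set of triples that realizes intersection. -/
def FormalSub (S : Set (Word k × Word k × Word k)) : Word k → Word k → Prop :=
  Relation.ReflTransGen fun c a => ∃ b, (a, b, c) ∈ S ∨ (b, a, c) ∈ S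

namespace EffSpace

/-- The sets `{a | x ∈ ν(a)}` for the points `x` of `K`. -/
def traces (X : EffSpace.{u} k) (K : Set X) : Set (Set (Word k)) :=
  (fun x => {a | x ∈ X.nu a}) '' K

theorem kappa_iff (X : EffSpace.{u} k) {p : OmegaWord k} {K : Compacts X} :
    X.kappa p K ↔ IsCoverName X.dom (X.traces K) fun w => InSeq w p := by
  refine forall_congr' fun w => ?_
  rw [traces, Set.forall_mem_image]
  rfl

theorem sUnion_traces (X : EffSpace.{u} k) (K : Set X) :
    ⋃₀ X.traces K = {a | (X.nu a ∩ K).Nonempty} := by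
  ext a
  simp only [traces, Set.sUnion_image, Set.mem_iUnion, Set.mem_ofPred_eq]
  exact ⟨fun ⟨x, hx, ha⟩ => ⟨x, ha, hx⟩, fun ⟨x, ha, hx⟩ => ⟨x, hx, ha⟩⟩

theorem sUnion_traces_subset (X : EffSpace.{u} k) (K : Set X) : ⋃₀ X.traces K ⊆ X.dom := by
  rw [sUnion_traces]
  rintro a ⟨x, hx, -⟩
  exact X.mem_dom hx

theorem kappaMin_iff (X : EffSpace.{u} k) {p : OmegaWord k} {K : Compacts X} :
    X.kappaMin p K ↔ IsCoverName (⋃₀ X.traces K) (X.traces K) fun w => InSeq w p := by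
  refine forall_congr' fun w => ?_
  rw [sUnion_traces, traces, Set.forall_mem_image]
  refine iff_congr Iff.rfl ⟨fun h => ⟨h.2.2, h.2.1⟩, fun h => ⟨fun a ha => ?_, h.2, h.1⟩⟩
  obtain ⟨x, hx, -⟩ := h.1 a ha
  exact X.mem_dom hx

/-- A triple `(a, b, c)` of `S` forces `ν(c) ⊆ ν(a) ∩ ν(b)`, so formal inclusion is sound.
Intersecting at a point with one set after another gives common formal lower bounds. `D` need only
contain the traces, which covers both `κ` and `κ̃`. -/
theorem isCompactTrace (X : EffSpace.{u} k) {S : Set (Word k × Word k × Word k)}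
    (hS : X.Intersects S) {K : Set X} (hK : IsCompact K) {D : Set (Word k)}
    (hD : ⋃₀ X.traces K ⊆ D) : IsCompactTrace D (X.traces K) (FormalSub S) where
  subset T hT := (Set.subset_sUnion_of_mem hT).trans hD
  mem_of_sub := by
    rintro _ ⟨x, hx, rfl⟩ c hc a hca
    have hstep : ∀ c a, x ∈ X.nu c → (∃ b, (a, b, c) ∈ S ∨ (b, a, c) ∈ S) → x ∈ X.nu a := by
      rintro c a hc ⟨b, hab | hba⟩
      · obtain ⟨ha, hb, -⟩ := hS.1 _ _ _ hab
        have : x ∈ X.nu a ∩ X.nu b := by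
          rw [hS.2 a ha b hb]
          exact ⟨c, hab, hc⟩
        exact this.1
      · obtain ⟨hb, ha, -⟩ := hS.1 _ _ _ hba
        have : x ∈ X.nu b ∩ X.nu a := by
          rw [hS.2 b hb a ha]
          exact ⟨c, hba, hc⟩
        exact this.2
    induction hca with
    | refl => exact hc
    | tail _ h ih => exact hstep _ _ ih h
  exists_sub := by
    rintro _ ⟨x, hx, rfl⟩ l hl
    induction l with
    | nil =>
      obtain ⟨_, ⟨a, -, rfl⟩, hxa, -⟩ :=
        X.isBasis.exists_subset_of_mem_open (Set.mem_univ x) isOpen_univ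
      exact ⟨a, hxa, by simp⟩
    | cons a l ih =>
      obtain ⟨c, hc, hsub⟩ := ih fun b hb => hl b (by simp [hb])
      have ha : x ∈ X.nu a := hl a (by simp)
      have hx' : x ∈ X.nu a ∩ X.nu c := ⟨ha, hc⟩
      rw [hS.2 a (X.mem_dom ha) c (X.mem_dom hc)] at hx'
      obtain ⟨d, hd, hxd⟩ := hx'
      refine ⟨d, hxd, fun b hb => ?_⟩
      rcases List.mem_cons.1 hb with rfl | hb
      · exact Relation.ReflTransGen.single ⟨c, Or.inl hd⟩
      · exact Relation.ReflTransGen.head ⟨a, Or.inr hd⟩ (hsub b hb)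
  exists_finite := by
    intro f hf
    have hf' : ∀ x ∈ K, x ∈ X.nu (f {a | x ∈ X.nu a}) := fun x hx => hf _ ⟨x, hx, rfl⟩
    obtain ⟨t, ht, hcov⟩ := hK.elim_nhds_subcover (fun x => X.nu (f {a | x ∈ X.nu a}))
      fun x hx => (X.isBasis.isOpen ⟨_, X.mem_dom (hf' x hx), rfl⟩).mem_nhds (hf' x hx)
    refine ⟨t.toList.map fun x => f {a | x ∈ X.nu a}, ?_, ?_⟩
    · intro c hc
      obtain ⟨x, hx, rfl⟩ := List.mem_map.1 hc
      exact ⟨_, ⟨x, ht x (Finset.mem_toList.1 hx), rfl⟩, rfl⟩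
    · rintro _ ⟨x, hx, rfl⟩
      obtain ⟨z, hz, hxz⟩ := Set.mem_iUnion₂.1 (hcov hx)
      exact ⟨_, List.mem_map.2 ⟨z, Finset.mem_toList.2 hz, rfl⟩, hxz⟩

end EffSpace

/-! ### Binary and finite products -/

/-- The words `⟨a,b⟩` with `a ∈ A` and `b ∈ B`. -/
def pairSet (A B : Set (Word k)) : Set (Word k) := {v | ∃ a ∈ A, ∃ b ∈ B, v = tuple [a, b]}

/-- The word `⟨…⟨⟨u₁,u₂⟩,u₃⟩…,uₙ⟩`. -/
def leftPair (us : List (Word k)) : Word k :=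
  us.tail.foldl (fun a b => tuple [a, b]) us.headI

/-- `v` denotes the `n + 1` words `us` by left-nested pairing. -/
def PairDec (n : ℕ) (v : Word k) (us : List (Word k)) : Prop :=
  us.length = n + 1 ∧ v = leftPair us

theorem leftPair_concat {us : List (Word k)} (h : us ≠ []) (b : Word k) :
    leftPair (us ++ [b]) = tuple [leftPair us, b] := by
  cases us with
  | nil => exact absurd rfl h
  | cons a us => simp [leftPair]

theorem pairDec_succ {n : ℕ} {v : Word k} {us : List (Word k)} :
    PairDec (n + 1) v us ↔ ∃ a b vs, us = vs ++ [b] ∧ PairDec n a vs ∧ v = tuple [a, b] := by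
  constructor
  · rintro ⟨hlen, rfl⟩
    have hne : us ≠ [] := by
      rintro rfl
      simp at hlen
    obtain ⟨vs, b, rfl⟩ : ∃ vs b, us = vs ++ [b] :=
      ⟨_, _, (List.dropLast_append_getLast hne).symm⟩
    have hlen' : vs.length = n + 1 := by simpa using hlen
    have hne' : vs ≠ [] := by
      rintro rfl
      simp at hlen'
    exact ⟨leftPair vs, b, vs, rfl, ⟨hlen', rfl⟩, leftPair_concat hne' b⟩
  · rintro ⟨_, b, vs, rfl, ⟨hlen, rfl⟩, rfl⟩
    have hne : vs ≠ [] := by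
      rintro rfl
      simp at hlen
    exact ⟨by simp [hlen], (leftPair_concat hne b).symm⟩

/-- The fixed length is essential: the lists `[⟨a,b⟩]` and `[a,b]` yield the same word under
`leftPair`. -/
theorem PairDec.unique {n : ℕ} {v : Word k} {us us' : List (Word k)} (h : PairDec n v us)
    (h' : PairDec n v us') : us = us' := by
  induction n generalizing v us us' with
  | zero =>
    obtain ⟨h1, rfl⟩ := h
    obtain ⟨h2, h3⟩ := h'
    obtain ⟨a, rfl⟩ := List.length_eq_one_iff.1 h1
    obtain ⟨b, rfl⟩ := List.length_eq_one_iff.1 h2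
    simpa [leftPair] using h3
  | succ n ih =>
    obtain ⟨a, b, vs, rfl, hv, rfl⟩ := pairDec_succ.1 h
    obtain ⟨a', b', vs', rfl, hv', he⟩ := pairDec_succ.1 h'
    have := tuple_injective he
    simp only [List.cons.injEq, and_true] at this
    obtain ⟨rfl, rfl⟩ := this
    rw [ih hv hv']

theorem box_pairDec_zero (A : ℕ → Set (Word k)) : box (PairDec 0) A = A 0 := by
  ext v
  constructor
  · rintro ⟨us, ⟨h1, rfl⟩, h⟩
    obtain ⟨a, rfl⟩ := List.length_eq_one_iff.1 h1
    exact h 0 a rfl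
  · intro h
    refine ⟨[v], ⟨rfl, rfl⟩, fun i a ha => ?_⟩
    cases i with
    | zero =>
      simp at ha
      rwa [← ha]
    | succ i => simp at ha

theorem box_pairDec_succ (A : ℕ → Set (Word k)) (n : ℕ) :
    box (PairDec (n + 1)) A = pairSet (box (PairDec n) A) (A (n + 1)) := by
  ext v
  constructor
  · rintro ⟨us, hd, h⟩
    obtain ⟨a, b, vs, rfl, hv, rfl⟩ := pairDec_succ.1 hd
    refine ⟨a, ⟨vs, hv, fun i c hc => h i c ?_⟩, b, h (n + 1) b ?_, rfl⟩
    · rw [List.getElem?_append_left (List.getElem?_eq_some_iff.1 hc).1, hc]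
    · rw [← hv.1]
      simp
  · rintro ⟨a, ⟨vs, hv, h⟩, b, hb, rfl⟩
    refine ⟨_, pairDec_succ.2 ⟨a, b, vs, rfl, hv, rfl⟩, fun i c hc => ?_⟩
    rcases lt_trichotomy i vs.length with hi | rfl | hi
    · rw [List.getElem?_append_left hi] at hc
      exact h i c hc
    · rw [hv.1]
      simp at hc
      rwa [← hc]
    · rw [List.getElem?_eq_none (by simp; omega)] at hc
      simp at hc

theorem boxes_pairDec_zero {𝒦 : ℕ → Set (Set (Word k))} (hne : ∀ i, 0 < i → (𝒦 i).Nonempty) :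
    boxes (PairDec 0) 𝒦 = 𝒦 0 := by
  ext B
  simp only [boxes, box_pairDec_zero, Set.mem_ofPred_eq]
  constructor
  · rintro ⟨T, hT, rfl⟩
    exact hT 0
  · intro hB
    refine ⟨fun i => if h : 0 < i then (hne i h).choose else B, fun i => ?_, by simp⟩
    by_cases h : 0 < i
    · simpa [h] using (hne i h).choose_spec
    · have : i = 0 := by omega
      subst this
      simpa using hB

/-- Boxes require an entry at every index. Since `𝒦 (n + 1)` may be empty, the left factor is
described by a family `𝒦'` that is padded from there on. -/
theorem boxes_pairDec_succ {𝒦 𝒦' : ℕ → Set (Set (Word k))} {n : ℕ}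
    (h : ∀ i ≤ n, 𝒦' i = 𝒦 i) (hne' : ∀ i, n < i → (𝒦' i).Nonempty)
    (hne : ∀ i, n + 1 < i → (𝒦 i).Nonempty) :
    boxes (PairDec (n + 1)) 𝒦
      = {B | ∃ T ∈ boxes (PairDec n) 𝒦', ∃ U ∈ 𝒦 (n + 1), B = pairSet T U} := by
  have hlt : ∀ (v : Word k) us, PairDec n v us → ∀ i < us.length, i ≤ n := by
    rintro v us ⟨hl, -⟩ i hi
    omega
  ext B
  constructor
  · rintro ⟨T, hT, rfl⟩
    rw [box_pairDec_succ]
    refine ⟨_, ⟨fun i => if h : n < i then (hne' i h).choose else T i, fun i => ?_, rfl⟩,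
      T (n + 1), hT _, ?_⟩
    · by_cases hi : n < i
      · simpa [hi] using (hne' i hi).choose_spec
      · simpa [hi, h i (not_lt.1 hi)] using hT i
    · congr 1
      exact box_congr fun v us hd i hi => by simp [hlt v us hd i hi]
  · rintro ⟨_, ⟨T, hT, rfl⟩, U, hU, rfl⟩
    refine ⟨fun i => if i ≤ n then T i else if h : n + 1 < i then (hne i h).choose else U,
      fun i => ?_, ?_⟩
    · by_cases hi : i ≤ n
      · simpa [hi, ← h i hi] using hT i
      · by_cases hi' : n + 1 < i
        · simpa [hi, hi'] using (hne i hi').choose_spec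
        · have : i = n + 1 := by omega
          subst this
          simpa using hU
    · rw [box_pairDec_succ]
      congr 1
      · exact box_congr fun v us hd i hi => by simp [hlt v us hd i hi]
      · simp

/-- `v` denotes the non-empty list `us` by tupling. -/
def TupleDec (v : Word k) (us : List (Word k)) : Prop := us ≠ [] ∧ v = tuple us

namespace EffSpace

theorem traces_prodCompacts (X : EffSpace.{u} k) (Y : EffSpace.{v} k)
    (K : Compacts X × Compacts Y) : (X.prod Y).traces (prodCompacts X Y K)
      = {B | ∃ T ∈ X.traces K.1, ∃ U ∈ Y.traces K.2, B = pairSet T U} := by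
  have h : ∀ z : X × Y, {w | z ∈ prodNu X Y w}
      = pairSet {a | z.1 ∈ X.nu a} {b | z.2 ∈ Y.nu b} := by
    intro z
    ext w
    constructor
    · rintro ⟨a, b, rfl, ha, hb⟩
      exact ⟨a, ha, b, hb, rfl⟩
    · rintro ⟨a, ha, b, hb, rfl⟩
      exact ⟨a, b, rfl, ha, hb⟩
  ext B
  constructor
  · rintro ⟨z, ⟨hz1, hz2⟩, rfl⟩
    exact ⟨_, ⟨z.1, hz1, rfl⟩, _, ⟨z.2, hz2, rfl⟩, h z⟩
  · rintro ⟨_, ⟨x, hx, rfl⟩, _, ⟨y, hy, rfl⟩, rfl⟩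
    exact ⟨(x, y), ⟨hx, hy⟩, h (x, y)⟩

theorem dom_finProd (X : ℕ → EffSpace.{u} k) (n : ℕ) :
    (finProd X n).dom = box (PairDec n) fun i => (X i).dom := by
  induction n with
  | zero => rw [box_pairDec_zero]; rfl
  | succ n ih => rw [box_pairDec_succ, ← ih]; rfl

theorem traces_finProdCompacts (X : ℕ → EffSpace.{u} k) {n : ℕ}
    (K : ∀ i : Fin (n + 1), Compacts (X i)) {𝒦 : ℕ → Set (Set (Word k))}
    (h : ∀ i : Fin (n + 1), 𝒦 i = (X i).traces (K i)) (hne : ∀ i, n < i → (𝒦 i).Nonempty) :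
    (finProd X n).traces (finProdCompacts X n K) = boxes (PairDec n) 𝒦 := by
  induction n generalizing 𝒦 with
  | zero =>
    rw [boxes_pairDec_zero hne]
    exact (h 0).symm
  | succ n ih =>
    -- The padding `{∅}` supplies an entry that `PairDec n` never consults.
    have hne' : ∀ i, n < i → ((if i ≤ n then 𝒦 i else {∅} : Set (Set (Word k)))).Nonempty := by
      intro i hi
      simp [not_le.2 hi]
    rw [boxes_pairDec_succ (𝒦' := fun i => if i ≤ n then 𝒦 i else {∅})
      (fun i hi => by simp [hi]) hne' hne,
      ← ih (fun i => K i.castSucc) (fun i => ?_) hne']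
    · refine (traces_prodCompacts (finProd X n) (X (n + 1)) _).trans ?_
      have := h (Fin.last (n + 1))
      simp only [Fin.val_last] at this
      rw [this]
    · have hi : (i : ℕ) ≤ n := by omega
      simp only [hi, if_true]
      exact h i.castSucc

theorem dom_countProd (X : ℕ → EffSpace.{u} k) :
    (countProd X).dom = box TupleDec fun i => (X i).dom := by
  ext v
  constructor
  · rintro ⟨us, h0, h1, h⟩
    refine ⟨us, ⟨h0, h1⟩, fun i a ha => ?_⟩
    obtain ⟨hi, rfl⟩ := List.getElem?_eq_some_iff.1 ha
    exact h i hi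
  · rintro ⟨us, ⟨h0, h1⟩, h⟩
    exact ⟨us, h0, h1, fun i hi => h i _ (List.getElem?_eq_getElem hi)⟩

theorem traces_countProdCompacts (X : ℕ → EffSpace.{u} k) (K : ∀ i, Compacts (X i)) :
    (countProd X).traces (countProdCompacts X K)
      = boxes TupleDec fun i => (X i).traces (K i) := by
  have h : ∀ z : ∀ i, X i, {w | z ∈ countNu X w} = box TupleDec fun i => {a | z i ∈ (X i).nu a} := by
    intro z
    ext w
    constructor
    · rintro ⟨us, h0, h1, h⟩
      refine ⟨us, ⟨h0, h1⟩, fun i a ha => ?_⟩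
      obtain ⟨hi, rfl⟩ := List.getElem?_eq_some_iff.1 ha
      exact h i hi
    · rintro ⟨us, ⟨h0, h1⟩, h⟩
      exact ⟨us, h0, h1, fun i hi => h i _ (List.getElem?_eq_getElem hi)⟩
  ext B
  constructor
  · rintro ⟨z, hz, rfl⟩
    exact ⟨_, fun i => ⟨z i, hz i (Set.mem_univ i), rfl⟩, h z⟩
  · rintro ⟨T, hT, rfl⟩
    -- One trace from each factor is given by one point from each factor, that is, by a point of the
    -- product.
    choose z hz hzT using hT
    refine ⟨z, fun i _ => hz i, ?_⟩
    refine (h z).trans (box_congr fun v us _ i _ => hzT i)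

end EffSpace

end Traces

/-! ## Semidecidability of the data of a product -/

section Data

variable {k : ℕ} {α β : Type*} [Primcodable α] [Primcodable β]

theorem OracleSemidec.formalSub {S : ℕ → Set (Word k × Word k × Word k)}
    (hS : OracleSemidec fun (p : ℕ × Word k × Word k × Word k) (_ : ℕ → β) => p.2 ∈ S p.1) :
    OracleSemidec fun (p : ℕ × Word k × Word k) (_ : ℕ → β) =>
      FormalSub (S p.1) p.2.1 p.2.2 := by
  have hstep : OracleSemidec fun (p : ℕ × Word k × Word k) (_ : ℕ → β) =>
      ∃ b, (p.2.2, b, p.2.1) ∈ S p.1 ∨ (b, p.2.2, p.2.1) ∈ S p.1 :=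
    ex (or
      (comp hS (f := fun q : (ℕ × Word k × Word k) × Word k =>
        (q.1.1, q.1.2.2, q.2, q.1.2.1)) (by fun_prop))
      (comp hS (f := fun q : (ℕ × Word k × Word k) × Word k =>
        (q.1.1, q.2, q.1.2.2, q.1.2.1)) (by fun_prop)))
  exact reflTransGen (R := fun i c a (_ : ℕ → β) => ∃ b, (a, b, c) ∈ S i ∨ (b, a, c) ∈ S i) hstep

theorem OracleSemidec.pairDec {f : α → ℕ} {g : α → Word k} {h : α → List (Word k)}
    (hf : Primrec f) (hg : Primrec g) (hh : Primrec h) :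
    OracleSemidec fun a (_ : ℕ → β) => PairDec (f a) (g a) (h a) := by
  have : Primrec fun a => leftPair (h a) := by
    unfold leftPair
    fun_prop
  exact and (eq (by fun_prop) (by fun_prop)) (eq hg this)

theorem OracleSemidec.tupleDec :
    OracleSemidec fun (p : Word k × List (Word k)) (_ : ℕ → β) => TupleDec p.1 p.2 := by
  refine OracleSemidec.and ?_ (eq (by fun_prop) (by fun_prop))
  exact (of_primrec (f := fun p : Word k × List (Word k) => !decide (p.2 = []))
    (by fun_prop)).of_iff fun p y => by simp

theorem OracleSemidec.input_eq {m : ℕ} (s : Fin m) {f : α → ℕ} {g : α → Option (Letter k)}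
    (hf : Primrec f) (hg : Primrec g) :
    OracleSemidec fun a (y : ℕ → Fin m → Option (Letter k)) => y (f a) s = g a := by
  have happ : Primrec fun p : α × (Fin m → Option (Letter k)) => p.2 s :=
    Primrec.fin_app.comp Primrec.snd (Primrec.const s)
  exact (query (R := fun a b => decide (b s = g a)) hf (by fun_prop)).of_iff fun a y => by simp

/-- The sequence that consists of the symbols on the tape `s` at the positions `f 0, f 1, …`. -/
def selectSeq {m : ℕ} (y : ℕ → Fin m → Option (Letter k)) (s : Fin m) (f : ℕ → ℕ) : OmegaWord k :=
  fun j => (y (f j) s).getD 0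

theorem OracleSemidec.inSeq_selectSeq {m : ℕ} (s : Fin m) {f : α → ℕ → ℕ} {g : α → Word k}
    (hf : Primrec fun p : α × ℕ => f p.1 p.2) (hg : Primrec g) :
    OracleSemidec fun a (y : ℕ → Fin m → Option (Letter k)) =>
      InSeq (g a) (selectSeq y s (f a)) := by
  refine inSeq hg ?_
  have happ : Primrec fun p : (α × ℕ × Letter k) × (Fin m → Option (Letter k)) => p.2 s :=
    Primrec.fin_app.comp Primrec.snd (Primrec.const s)
  have hf' : Primrec fun q : α × ℕ × Letter k => f q.1 q.2.1 :=
    hf.comp (f := fun p : α × ℕ => f p.1 p.2) (g := fun q : α × ℕ × Letter k => (q.1, q.2.1))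
      (by fun_prop)
  exact (query (R := fun (a : α × ℕ × Letter k) b => decide ((b s).getD 0 = a.2.2)) hf'
    (by fun_prop)).of_iff fun a y => by simp [selectSeq]

theorem seqTuple_mul_add {n : ℕ} (p : Fin (n + 1) → OmegaWord k) (i : Fin (n + 1)) (j : ℕ) :
    seqTuple p ((n + 1) * j + i) = p i j := by
  have h1 : ((n + 1) * j + i) % (n + 1) = i := by
    rw [Nat.mul_add_mod, Nat.mod_eq_of_lt i.2]
  have h2 : ((n + 1) * j + i) / (n + 1) = j := by
    rw [Nat.mul_add_div n.succ_pos, Nat.div_eq_of_lt i.2, Nat.add_zero]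
  unfold seqTuple
  simp only [h1, h2]

end Data

/-! ## Simulation of machines on words -/

namespace Type2Machine

variable {k : ℕ}

/-- The computation of a machine with one input tape, on an input word. -/
def run (M : Type2Machine k 1) (w : Word k) (t : ℕ) : M.Mem × ℕ × Word k :=
  -- A tuple of codable data replaces `Config`, so that `Computable.nat_rec` applies to the
  -- iteration.
  Nat.rec (M.start, 0, []) (fun _ c =>
    ((M.step c.1 fun _ => w[c.2.1]?).1,
      (bif (M.step c.1 fun _ => w[c.2.1]?).2.1 0 then c.2.1 + 1 else c.2.1),
      c.2.2 ++ (M.step c.1 fun _ => w[c.2.1]?).2.2.toList)) t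

theorem config_wordTape (M : Type2Machine k 1) (w : Word k) (t : ℕ) :
    M.config ![wordTape w] t
      = ⟨(M.run w t).1, fun _ => (M.run w t).2.1, (M.run w t).2.2⟩ := by
  induction t with
  | zero => rfl
  | succ t ih =>
    have hin : (fun i => (![wordTape w] : Fin 1 → InTape k) i (M.run w t).2.1)
        = fun _ => w[(M.run w t).2.1]? := by
      funext i
      fin_cases i
      rfl
    rw [config, ih]
    simp only [hin]
    congr 1
    funext i
    fin_cases i
    simp only [run, cond_eq_ite]
    rfl

theorem computable_run (M : Type2Machine k 1) :
    letI := M.primcodable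
    Computable fun p : Word k × ℕ => M.run p.1 p.2 := by
  let := M.primcodable
  have hsym : Computable fun q : (Word k × ℕ) × ℕ × M.Mem × ℕ × Word k =>
      (fun _ => q.1.1[q.2.2.2.1]? : Fin 1 → Option (Letter k)) :=
    (Primrec.dom_finite fun (o : Option (Letter k)) (_ : Fin 1) => o).to_comp.comp
      (Computable.list_getElem?.comp (Computable.fst.comp Computable.fst)
        (Computable.fst.comp (Computable.snd.comp (Computable.snd.comp Computable.snd))))
  have hmem : Computable fun q : (Word k × ℕ) × ℕ × M.Mem × ℕ × Word k => q.2.2.1 :=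
    Computable.fst.comp (Computable.snd.comp Computable.snd)
  have hpos : Computable fun q : (Word k × ℕ) × ℕ × M.Mem × ℕ × Word k => q.2.2.2.1 :=
    Computable.fst.comp (Computable.snd.comp (Computable.snd.comp Computable.snd))
  have hout : Computable fun q : (Word k × ℕ) × ℕ × M.Mem × ℕ × Word k => q.2.2.2.2 :=
    Computable.snd.comp (Computable.snd.comp (Computable.snd.comp Computable.snd))
  have hstep : Computable fun q : (Word k × ℕ) × ℕ × M.Mem × ℕ × Word k =>
      M.step q.2.2.1 fun _ => q.1.1[q.2.2.2.1]? := M.step_computable.comp hmem hsym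
  have hmove : Computable fun q : (Word k × ℕ) × ℕ × M.Mem × ℕ × Word k =>
      (M.step q.2.2.1 fun _ => q.1.1[q.2.2.2.1]?).2.1 0 :=
    (Primrec.dom_finite fun f : Fin 1 → Bool => f 0).to_comp.comp
      (Computable.fst.comp (Computable.snd.comp hstep))
  have hwrite : Computable fun q : (Word k × ℕ) × ℕ × M.Mem × ℕ × Word k =>
      (M.step q.2.2.1 fun _ => q.1.1[q.2.2.2.1]?).2.2.toList :=
    Primrec.optionToList.to_comp.comp (Computable.snd.comp (Computable.snd.comp hstep))
  exact Computable.nat_rec Computable.snd (Computable.const _)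
    ((Computable.fst.comp hstep).pair ((Computable.cond hmove (Computable.succ.comp hpos) hpos).pair
      (Computable.list_append.comp hout hwrite))).to₂

theorem out_prefix {m : ℕ} (M : Type2Machine k m) (y : Fin m → InTape k) {t t' : ℕ} (h : t ≤ t') :
    (M.config y t).out <+: (M.config y t').out := by
  induction h with
  | refl => exact List.prefix_refl _
  | step _ ih => exact ih.trans (List.prefix_append _ _)

theorem getElem?_eq_some_of_prefix {α : Type*} {l l' : List α} (h : l <+: l') {n : ℕ} {a : α}
    (ha : l[n]? = some a) : l'[n]? = some a := by
  obtain ⟨r, rfl⟩ := h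
  rw [List.getElem?_append_left (List.getElem?_eq_some_iff.1 ha).1, ha]

/-- The output only grows, so a symbol once written at position `n` is final. -/
theorem Computes.eq_iff {m : ℕ} {M : Type2Machine k m} {y : Fin m → InTape k} {q : OmegaWord k}
    (h : M.Computes y q) (n : ℕ) (c : Letter k) :
    q n = c ↔ ∃ t, (M.config y t).out[n]? = some c := by
  constructor
  · rintro rfl
    exact h n
  · rintro ⟨t, ht⟩
    obtain ⟨t', ht'⟩ := h n
    rcases le_total t t' with hle | hle
    · have := getElem?_eq_some_of_prefix (M.out_prefix y hle) ht
      rw [ht'] at this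
      exact Option.some.inj this
    · have := getElem?_eq_some_of_prefix (M.out_prefix y hle) ht'
      rw [ht] at this
      exact (Option.some.inj this).symm

end Type2Machine

/-! ### Uniform semidecidability from computable sequences of names -/

theorem Computable.decide_eq_comp {α β : Type*} [Primcodable α] [Primcodable β] [DecidableEq β]
    {f g : α → β} (hf : Computable f) (hg : Computable g) :
    Computable fun a => decide (f a = g a) :=
  Computable₂.comp (Primrec.eq.decide).to_comp hf hg

theorem WordComputable.oracleSemidec {k : ℕ} {α β : Type*} [Primcodable α] [Primcodable β]
    {g : Word k →. OmegaWord k} (hg : WordComputable g) {f : α → Word k} (hf : Primrec f)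
    {q : α → OmegaWord k} (hq : ∀ a, q a ∈ g (f a)) :
    OracleSemidec fun (p : α × ℕ × Letter k) (_ : ℕ → β) => q p.1 p.2.1 = p.2.2 := by
  obtain ⟨M, hM⟩ := hg
  let := M.primcodable
  have hrun : Computable fun p : (α × ℕ × Letter k) × ℕ =>
      decide ((M.run (f p.1.1) p.2).2.2[p.1.2.1]? = some p.1.2.2) := by
    have h1 : Computable fun p : (α × ℕ × Letter k) × ℕ => (M.run (f p.1.1) p.2).2.2 :=
      Computable.snd.comp (Computable.snd.comp (M.computable_run.comp
        (f := fun p : Word k × ℕ => M.run p.1 p.2)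
        (g := fun p : (α × ℕ × Letter k) × ℕ => (f p.1.1, p.2))
        (Primrec.to_comp (by fun_prop))))
    have h2 : Computable fun p : (α × ℕ × Letter k) × ℕ =>
        (M.run (f p.1.1) p.2).2.2[p.1.2.1]? :=
      Computable.list_getElem?.comp h1 (Primrec.to_comp (by fun_prop))
    exact Computable.decide_eq_comp h2 (Primrec.to_comp (by fun_prop))
  have hex : OracleSemidec fun (p : α × ℕ × Letter k) (_ : ℕ → β) =>
      ∃ t, (M.run (f p.1) t).2.2[p.2.1]? = some p.2.2 :=
    OracleSemidec.ex (OracleSemidec.of_re (Computable.computablePred hrun).to_re)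
  refine hex.of_iff fun p y => ?_
  rw [((hM _ _).1 (hq p.1)).eq_iff]
  simp only [Type2Machine.config_wordTape]

namespace EffSpace

theorem ComputableSequence.exists_intersects {k : ℕ} {X : ℕ → EffSpace.{u} k}
    (hX : ComputableSequence X) (β : Type) [Primcodable β] :
    ∃ S : ℕ → Set (Word k × Word k × Word k),
      (OracleSemidec fun (p : ℕ × Word k × Word k × Word k) (_ : ℕ → β) => p.2 ∈ S p.1) ∧
      ∀ i, (X i).Intersects (S i) := by
  obtain ⟨g, hg, h⟩ := hX
  choose q hq r s hqrs _ S hS hXS using h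
  refine ⟨S, ?_, hXS⟩
  have hsym : OracleSemidec fun (p : ℕ × ℕ × Letter k) (_ : ℕ → β) => s p.1 p.2.1 = p.2.2 := by
    have := hg.oracleSemidec (β := β) (f := fun i : ℕ => unary (i + 1)) (by fun_prop) hq
    -- In `⟨r,s⟩` the enumeration `s` of the triples occupies the odd positions.
    refine (this.comp (f := fun p : ℕ × ℕ × Letter k => (p.1, 2 * p.2.1 + 1, p.2.2))
      (by fun_prop)).of_iff fun p y => ?_
    have := seqTuple_mul_add ![r p.1, s p.1] 1 p.2.1
    simp only [hqrs]
    rw [show 2 * p.2.1 + 1 = (1 + 1) * p.2.1 + ((1 : Fin 2) : ℕ) from rfl, this]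
    rfl
  have := OracleSemidec.inSeq
    (f := fun p : ℕ × Word k × Word k × Word k => tuple [p.2.1, p.2.2.1, p.2.2.2])
    (p := fun p (_ : ℕ → β) => s p.1) (by fun_prop)
    (hsym.comp (f := fun q : (ℕ × Word k × Word k × Word k) × ℕ × Letter k =>
      (q.1.1, q.2.1, q.2.2)) (by fun_prop))
  refine this.of_iff fun p y => ?_
  rw [hS p.1]
  constructor
  · intro h
    exact ⟨_, _, _, h, rfl⟩
  · rintro ⟨a, b, c, h, he⟩
    have := tuple_injective he
    simp only [List.cons.injEq, and_true] at this
    obtain ⟨h1, h2, h3⟩ := this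
    rw [← h1, ← h2, ← h3] at h
    exact h

end EffSpace

/-! ## Computing names of products -/

section Names

variable {k : ℕ}

theorem isCoverName_finite_product {n : ℕ} {p : Fin (n + 1) → OmegaWord k}
    {D : ℕ → Set (Word k)} {𝒦 : ℕ → Set (Set (Word k))} {S : ℕ → Set (Word k × Word k × Word k)}
    (hp : ∀ i : Fin (n + 1), IsCoverName (D i) (𝒦 i) fun w => InSeq w (p i))
    (h𝒦 : ∀ i : Fin (n + 1), IsCompactTrace (D i) (𝒦 i) (FormalSub (S i)))
    (hne : ∀ i, n < i → (𝒦 i).Nonempty) {E : ℕ → Word k → Prop}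
    (hE : ∀ i w, E i w ↔ ∃ h : i < n + 1, InSeq w (p ⟨i, h⟩)) :
    IsCoverName (box (PairDec n) D) (boxes (PairDec n) 𝒦)
      (ProductCover (PairDec n) E fun i => FormalSub (S i)) := by
  refine isCoverName_productCover (I := {i | i < n + 1}) (fun i hi => ?_)
    (fun i hi w hw => hi ((hE i w).1 hw).1) (fun i hi => h𝒦 ⟨i, hi⟩)
    (fun i hi => hne i (Nat.lt_of_succ_le (not_lt.1 hi))) (fun i hi j hj => lt_of_le_of_lt hj hi)
    (fun v us hd i hi => hd.1 ▸ hi) fun v us us' => PairDec.unique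
  have : E i = fun w => InSeq w (p ⟨i, hi⟩) := by
    funext w
    exact propext ((hE i w).trans ⟨fun ⟨_, h⟩ => h, fun h => ⟨hi, h⟩⟩)
  rw [this]
  exact hp ⟨i, hi⟩

theorem exists_lt_and_inSeq_iff {n m i : ℕ} (p : Fin (n + 1) → OmegaWord k)
    {y : ℕ → Fin m → Option (Letter k)} {s : Fin m} (hy : ∀ t, y t s = some (seqTuple p t))
    (w : Word k) : (i < n + 1 ∧ InSeq w (selectSeq y s fun j => (n + 1) * j + i)) ↔
      ∃ h : i < n + 1, InSeq w (p ⟨i, h⟩) := by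
  have : ∀ h : i < n + 1, (selectSeq y s fun j => (n + 1) * j + i) = p ⟨i, h⟩ := by
    intro h
    funext j
    rw [selectSeq, hy, ← seqTuple_mul_add p ⟨i, h⟩ j]
    rfl
  exact ⟨fun ⟨h, hw⟩ => ⟨h, this h ▸ hw⟩, fun ⟨h, hw⟩ => ⟨h, (this h).symm ▸ hw⟩⟩

/-- Names of binary products can be computed. -/
theorem exists_computable_pair {S₁ S₂ : Set (Word k × Word k × Word k)}
    (h₁ : REPred fun t => t ∈ S₁) (h₂ : REPred fun t => t ∈ S₂) :
    ∃ g : OmegaWord k →. OmegaWord k, SeqComputable g ∧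
      ∀ (p p' : OmegaWord k) (D D' : Set (Word k)) (𝒦 𝒦' : Set (Set (Word k))),
        IsCoverName D 𝒦 (fun w => InSeq w p) → IsCoverName D' 𝒦' (fun w => InSeq w p') →
        IsCompactTrace D 𝒦 (FormalSub S₁) → IsCompactTrace D' 𝒦' (FormalSub S₂) →
        ∃ q ∈ g (seqTuple ![p, p']), IsCoverName (pairSet D D')
          {B | ∃ T ∈ 𝒦, ∃ U ∈ 𝒦', B = pairSet T U} fun w => InSeq w q := by
  let S : ℕ → Set (Word k × Word k × Word k) := fun i => if i = 0 then S₁ else S₂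
  have hS : OracleSemidec fun (p : ℕ × Word k × Word k × Word k)
      (_ : ℕ → Fin 1 → Option (Letter k)) => p.2 ∈ S p.1 := by
    refine (OracleSemidec.or
      ((OracleSemidec.eq Primrec.fst (Primrec.const 0)).and
        ((OracleSemidec.of_re h₁).comp Primrec.snd))
      ((OracleSemidec.lt (Primrec.const 0) Primrec.fst).and
        ((OracleSemidec.of_re h₂).comp Primrec.snd))).of_iff fun p y => ?_
    by_cases h : p.1 = 0
    · simp [S, h]
    · simp [S, h, Nat.pos_of_ne_zero h]
  have hE : OracleSemidec fun (q : ℕ × Word k) (y : ℕ → Fin 1 → Option (Letter k)) =>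
      q.1 < 1 + 1 ∧ InSeq q.2 (selectSeq y 0 fun j => (1 + 1) * j + q.1) :=
    OracleSemidec.and (OracleSemidec.lt (by fun_prop) (by fun_prop))
      (OracleSemidec.inSeq_selectSeq (f := fun (q : ℕ × Word k) j => (1 + 1) * j + q.1) 0
        (by fun_prop) (by fun_prop))
  have hP := OracleSemidec.productCover (Dec := fun _ => PairDec 1)
    (E := fun y i w => i < 1 + 1 ∧ InSeq w (selectSeq y 0 fun j => (1 + 1) * j + i))
    (Sub := fun _ i => FormalSub (S i))
    (OracleSemidec.pairDec (by fun_prop) (by fun_prop) (by fun_prop)) hE hS.formalSub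
  obtain ⟨g, hg, hgP⟩ := exists_seqComputable hP
  refine ⟨g, hg, fun p p' D D' 𝒦 𝒦' hD hD' h𝒦 h𝒦' => ?_⟩
  obtain ⟨q, hq, hqP⟩ := hgP (seqTuple ![p, p'])
  refine ⟨q, hq, ?_⟩
  let A : ℕ → Set (Word k) := fun i => if i = 0 then D else D'
  -- Indices above `1` belong to no factor and are padded with `{∅}`.
  let 𝒜 : ℕ → Set (Set (Word k)) := fun i => if i = 0 then 𝒦 else if i = 1 then 𝒦' else {∅}
  have h := isCoverName_finite_product (n := 1) (p := ![p, p']) (D := A) (𝒦 := 𝒜) (S := S)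
    (by
      intro i
      fin_cases i
      · exact hD
      · exact hD')
    (by
      intro i
      fin_cases i
      · exact h𝒦
      · exact h𝒦')
    (by
      intro i hi
      have h0 : i ≠ 0 := by omega
      have h1 : i ≠ 1 := by omega
      simp [𝒜, h0, h1])
    (fun i w => exists_lt_and_inSeq_iff (m := 1) (i := i) ![p, p']
      (y := fun t _ => some (seqTuple ![p, p'] t)) (s := 0) (fun t => rfl) w)
  have hne : ∀ i, 0 < i → ((if i = 0 then 𝒦 else {∅} : Set (Set (Word k)))).Nonempty := by
    intro i hi
    simp [hi.ne']
  rw [box_pairDec_succ, box_pairDec_zero, boxes_pairDec_succ (n := 0)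
    (𝒦' := fun i => if i = 0 then 𝒦 else {∅}) (by
      intro i hi
      have : i = 0 := by omega
      simp [𝒜, this]) hne (by
      intro i hi
      have h0 : i ≠ 0 := by omega
      have h1 : i ≠ 1 := by omega
      simp [𝒜, h0, h1]), boxes_pairDec_zero hne] at h
  intro w
  exact (hqP w).trans (h w)

/-- Names of finite products can be computed. -/
theorem exists_computable_finite {S : ℕ → Set (Word k × Word k × Word k)}
    (hS : OracleSemidec fun (p : ℕ × Word k × Word k × Word k)
      (_ : ℕ → Fin 2 → Option (Letter k)) => p.2 ∈ S p.1) :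
    ∃ f : Word k → OmegaWord k →. OmegaWord k, WordSeqComputable f ∧
      ∀ (n : ℕ) (p : Fin (n + 1) → OmegaWord k) (D : ℕ → Set (Word k))
        (𝒦 : ℕ → Set (Set (Word k))),
        (∀ i : Fin (n + 1), IsCoverName (D i) (𝒦 i) fun w => InSeq w (p i)) →
        (∀ i : Fin (n + 1), IsCompactTrace (D i) (𝒦 i) (FormalSub (S i))) →
        (∀ i, n < i → (𝒦 i).Nonempty) →
        ∃ q ∈ f (unary (n + 1)) (seqTuple p),
          IsCoverName (box (PairDec n) D) (boxes (PairDec n) 𝒦) fun w => InSeq w q := by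
  -- On the tape of `0ⁿ⁺¹` position `n` carries the last `0` and position `n + 1` the first blank.
  -- Blanks are visible to the machine, so the number of factors is found by search, and it is
  -- unique.
  let Len : (ℕ → Fin 2 → Option (Letter k)) → ℕ → Prop := fun y n =>
    y n 0 = some 0 ∧ y (n + 1) 0 = none
  have hLen : OracleSemidec fun n y => Len y n :=
    OracleSemidec.and (OracleSemidec.input_eq 0 (by fun_prop) (by fun_prop))
      (OracleSemidec.input_eq 0 (by fun_prop) (by fun_prop))
  have hDec : OracleSemidec fun (q : Word k × List (Word k)) y =>
      ∃ n, Len y n ∧ PairDec n q.1 q.2 :=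
    OracleSemidec.ex (OracleSemidec.and
      (hLen.comp (f := fun q : (Word k × List (Word k)) × ℕ => q.2) (by fun_prop))
      (OracleSemidec.pairDec (by fun_prop) (by fun_prop) (by fun_prop)))
  have hE : OracleSemidec fun (q : ℕ × Word k) y =>
      ∃ n, Len y n ∧ q.1 < n + 1 ∧ InSeq q.2 (selectSeq y 1 fun j => (n + 1) * j + q.1) :=
    OracleSemidec.ex (OracleSemidec.and
      (hLen.comp (f := fun q : (ℕ × Word k) × ℕ => q.2) (by fun_prop))
      (OracleSemidec.and (OracleSemidec.lt (by fun_prop) (by fun_prop))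
        (OracleSemidec.inSeq_selectSeq
          (f := fun (q : (ℕ × Word k) × ℕ) j => (q.2 + 1) * j + q.1.1) 1
          (by fun_prop) (by fun_prop))))
  have hP := OracleSemidec.productCover (Dec := fun y v us => ∃ n, Len y n ∧ PairDec n v us)
    (E := fun y i w => ∃ n, Len y n ∧ i < n + 1 ∧
      InSeq w (selectSeq y 1 fun j => (n + 1) * j + i))
    (Sub := fun _ i => FormalSub (S i)) hDec hE hS.formalSub
  obtain ⟨f, hf, hfP⟩ := exists_wordSeqComputable hP
  refine ⟨f, hf, fun n p D 𝒦 hp h𝒦 hne => ?_⟩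
  obtain ⟨q, hq, hqP⟩ := hfP (unary (n + 1)) (seqTuple p)
  refine ⟨q, hq, ?_⟩
  have hlen : ∀ m, Len (fun t => ![(unary (n + 1) : Word k)[t]?, some (seqTuple p t)]) m
      ↔ m = n := by
    intro m
    simp only [Len, unary, Matrix.cons_val_zero, List.getElem?_replicate]
    constructor
    · rintro ⟨h1, h2⟩
      split_ifs at h1 h2
      omega
    · rintro rfl
      simp
  simp only [hlen, exists_eq_left] at hqP
  intro w
  exact (hqP w).trans (isCoverName_finite_product hp h𝒦 hne
    (fun i w => exists_lt_and_inSeq_iff p (fun t => rfl) w) w)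

/-- Names of countable products can be computed. -/
theorem exists_computable_countable {S : ℕ → Set (Word k × Word k × Word k)}
    (hS : OracleSemidec fun (p : ℕ × Word k × Word k × Word k)
      (_ : ℕ → Fin 1 → Option (Letter k)) => p.2 ∈ S p.1) :
    ∃ g : OmegaWord k →. OmegaWord k, SeqComputable g ∧
      ∀ (p : ℕ → OmegaWord k) (r : OmegaWord k) (D : ℕ → Set (Word k))
        (𝒦 : ℕ → Set (Set (Word k))), IsSeqSeq p r →
        (∀ i, IsCoverName (D i) (𝒦 i) fun w => InSeq w (p i)) →
        (∀ i, IsCompactTrace (D i) (𝒦 i) (FormalSub (S i))) →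
        ∃ q ∈ g r, IsCoverName (box TupleDec D) (boxes TupleDec 𝒦) fun w => InSeq w q := by
  have hE : OracleSemidec fun (q : ℕ × Word k) (y : ℕ → Fin 1 → Option (Letter k)) =>
      InSeq q.2 (selectSeq y 0 fun j => cantorPair q.1 j) :=
    OracleSemidec.inSeq_selectSeq (f := fun (q : ℕ × Word k) j => cantorPair q.1 j) 0
      (by unfold cantorPair; fun_prop) (by fun_prop)
  have hP := OracleSemidec.productCover (Dec := fun _ => TupleDec)
    (E := fun y i w => InSeq w (selectSeq y 0 fun j => cantorPair i j))
    (Sub := fun _ i => FormalSub (S i)) OracleSemidec.tupleDec hE hS.formalSub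
  obtain ⟨g, hg, hgP⟩ := exists_seqComputable hP
  refine ⟨g, hg, fun p r D 𝒦 hr hp h𝒦 => ?_⟩
  obtain ⟨q, hq, hqP⟩ := hgP r
  refine ⟨q, hq, fun w => (hqP w).trans ?_⟩
  -- Every index belongs to a factor, so no padding is needed; the criterion still inspects only
  -- finitely many covers.
  refine isCoverName_productCover (I := Set.univ) (fun i _ => ?_)
    (fun i hi => absurd (Set.mem_univ i) hi) (fun i _ => h𝒦 i)
    (fun i hi => absurd (Set.mem_univ i) hi) (fun _ _ j _ => Set.mem_univ j)
    (fun _ _ _ i _ => Set.mem_univ i) (fun v us us' h h' => tuple_injective (h.2.symm.trans h'.2)) w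
  have : (selectSeq (fun t (_ : Fin 1) => some (r t)) 0 fun j => cantorPair i j) = p i := by
    funext j
    exact hr i j
  rw [this]
  exact hp i

end Names

/-! ### Products of compact sets in effective topological spaces -/

section Products

variable {k : ℕ}

namespace EffSpace

theorem sUnion_pairSet (𝒦 𝒦' : Set (Set (Word k))) :
    ⋃₀ {B | ∃ T ∈ 𝒦, ∃ U ∈ 𝒦', B = pairSet T U} = pairSet (⋃₀ 𝒦) (⋃₀ 𝒦') := by
  ext v
  constructor
  · rintro ⟨_, ⟨T, hT, U, hU, rfl⟩, a, ha, b, hb, rfl⟩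
    exact ⟨a, ⟨T, hT, ha⟩, b, ⟨U, hU, hb⟩, rfl⟩
  · rintro ⟨a, ⟨T, hT, ha⟩, b, ⟨U, hU, hb⟩, rfl⟩
    exact ⟨_, ⟨T, hT, U, hU, rfl⟩, a, ha, b, hb, rfl⟩

theorem computable_prodCompacts (X : EffSpace.{u} k) (Y : EffSpace.{v} k)
    (hX : X.IsComputable) (hY : Y.IsComputable) :
    RepComputable (X.kappa.prod Y.kappa) (X.prod Y).kappa
        (prodCompacts X Y : Compacts X × Compacts Y →. Compacts (X.prod Y)) ∧
      RepComputable (X.kappaMin.prod Y.kappaMin) (X.prod Y).kappaMin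
        (prodCompacts X Y : Compacts X × Compacts Y →. Compacts (X.prod Y)) := by
  obtain ⟨-, S₁, h₁, hS₁⟩ := hX
  obtain ⟨-, S₂, h₂, hS₂⟩ := hY
  obtain ⟨g, hg, H⟩ := exists_computable_pair h₁ h₂
  refine ⟨⟨g, hg, ?_⟩, ⟨g, hg, ?_⟩⟩
  · rintro _ K ⟨p, p', rfl, hp, hp'⟩ L hL
    rw [PFun.coe_val, Part.mem_some_iff] at hL
    subst hL
    obtain ⟨q, hq, hc⟩ := H p p' _ _ _ _ (X.kappa_iff.1 hp) (Y.kappa_iff.1 hp')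
      (X.isCompactTrace hS₁ K.1.isCompact (X.sUnion_traces_subset _))
      (Y.isCompactTrace hS₂ K.2.isCompact (Y.sUnion_traces_subset _))
    refine ⟨q, hq, (X.prod Y).kappa_iff.2 ?_⟩
    rwa [traces_prodCompacts]
  · rintro _ K ⟨p, p', rfl, hp, hp'⟩ L hL
    rw [PFun.coe_val, Part.mem_some_iff] at hL
    subst hL
    obtain ⟨q, hq, hc⟩ := H p p' _ _ _ _ (X.kappaMin_iff.1 hp) (Y.kappaMin_iff.1 hp')
      (X.isCompactTrace hS₁ K.1.isCompact subset_rfl)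
      (Y.isCompactTrace hS₂ K.2.isCompact subset_rfl)
    refine ⟨q, hq, (X.prod Y).kappaMin_iff.2 ?_⟩
    rwa [traces_prodCompacts, sUnion_pairSet]

/-- The traces of the first `n + 1` compact sets, followed by trivial entries. -/
def paddedTraces (X : ℕ → EffSpace.{u} k) {n : ℕ} (K : ∀ i : Fin (n + 1), Compacts (X i)) (i : ℕ) :
    Set (Set (Word k)) :=
  if h : i < n + 1 then (X i).traces (K ⟨i, h⟩) else {∅}

theorem paddedTraces_val (X : ℕ → EffSpace.{u} k) {n : ℕ}
    (K : ∀ i : Fin (n + 1), Compacts (X i)) (i : Fin (n + 1)) :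
    paddedTraces X K i = (X i).traces (K i) :=
  dif_pos i.2

theorem paddedTraces_nonempty (X : ℕ → EffSpace.{u} k) {n : ℕ}
    (K : ∀ i : Fin (n + 1), Compacts (X i)) (i : ℕ) (hi : n < i) :
    (paddedTraces X K i).Nonempty := by
  have : ¬ i < n + 1 := by omega
  simp [paddedTraces, this]

theorem computable_finProdCompacts (X : ℕ → EffSpace.{u} k) (hX : ComputableSequence X) :
    ∃ f : Word k → OmegaWord k →. OmegaWord k, WordSeqComputable f ∧ ∀ n : ℕ,
      Realizes (f (unary (n + 1)))
        (MultiRep.finProd fun i : Fin (n + 1) => (X i).kappa) (finProd X n).kappa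
        (finProdCompacts X n : (∀ i : Fin (n + 1), Compacts (X i)) →. Compacts (finProd X n)) ∧
      Realizes (f (unary (n + 1)))
        (MultiRep.finProd fun i : Fin (n + 1) => (X i).kappaMin) (finProd X n).kappaMin
        (finProdCompacts X n : (∀ i : Fin (n + 1), Compacts (X i)) →. Compacts (finProd X n)) := by
  obtain ⟨S, hS, hXS⟩ := hX.exists_intersects (Fin 2 → Option (Letter k))
  obtain ⟨f, hf, H⟩ := exists_computable_finite hS
  refine ⟨f, hf, fun n => ⟨?_, ?_⟩⟩
  · rintro _ K ⟨p, rfl, hp⟩ L hL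
    rw [PFun.coe_val, Part.mem_some_iff] at hL
    subst hL
    obtain ⟨q, hq, hc⟩ := H n p (fun i => (X i).dom) (paddedTraces X K)
      (fun i => by
        rw [paddedTraces_val]
        exact (X i).kappa_iff.1 (hp i))
      (fun i => by
        rw [paddedTraces_val]
        exact (X i).isCompactTrace (hXS i) (K i).isCompact ((X i).sUnion_traces_subset _))
      (paddedTraces_nonempty X K)
    refine ⟨q, hq, (finProd X n).kappa_iff.2 ?_⟩
    rwa [traces_finProdCompacts X K (paddedTraces_val X K) (paddedTraces_nonempty X K),
      dom_finProd]
  · rintro _ K ⟨p, rfl, hp⟩ L hL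
    rw [PFun.coe_val, Part.mem_some_iff] at hL
    subst hL
    obtain ⟨q, hq, hc⟩ := H n p (fun i => ⋃₀ paddedTraces X K i) (paddedTraces X K)
      (fun i => by
        rw [paddedTraces_val]
        exact (X i).kappaMin_iff.1 (hp i))
      (fun i => by
        rw [paddedTraces_val]
        exact (X i).isCompactTrace (hXS i) (K i).isCompact subset_rfl)
      (paddedTraces_nonempty X K)
    refine ⟨q, hq, (finProd X n).kappaMin_iff.2 ?_⟩
    rwa [traces_finProdCompacts X K (paddedTraces_val X K) (paddedTraces_nonempty X K),
      sUnion_boxes]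
    intro v us hd i hi
    exact paddedTraces_nonempty X K i (by rw [hd.1] at hi; omega)

theorem computable_countProdCompacts (X : ℕ → EffSpace.{u} k) (hX : ComputableSequence X) :
    RepComputable (MultiRep.countProd fun i => (X i).kappa) (countProd X).kappa
        (countProdCompacts X : (∀ i, Compacts (X i)) →. Compacts (countProd X)) ∧
      RepComputable (MultiRep.countProd fun i => (X i).kappaMin) (countProd X).kappaMin
        (PFun.res (countProdCompacts X) {K | ∀ i, (K i : Set (X i)).Nonempty}) := by
  obtain ⟨S, hS, hXS⟩ := hX.exists_intersects (Fin 1 → Option (Letter k))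
  obtain ⟨g, hg, H⟩ := exists_computable_countable hS
  refine ⟨⟨g, hg, ?_⟩, ⟨g, hg, ?_⟩⟩
  · rintro r K ⟨p, hr, hp⟩ L hL
    rw [PFun.coe_val, Part.mem_some_iff] at hL
    subst hL
    obtain ⟨q, hq, hc⟩ := H p r _ _ hr (fun i => (X i).kappa_iff.1 (hp i)) fun i =>
      (X i).isCompactTrace (hXS i) (K i).isCompact ((X i).sUnion_traces_subset _)
    refine ⟨q, hq, (countProd X).kappa_iff.2 ?_⟩
    rwa [traces_countProdCompacts, dom_countProd]
  · rintro r K ⟨p, hr, hp⟩ L hL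
    rw [PFun.mem_res] at hL
    obtain ⟨hK, rfl⟩ := hL
    obtain ⟨q, hq, hc⟩ := H p r _ _ hr (fun i => (X i).kappaMin_iff.1 (hp i)) fun i =>
      (X i).isCompactTrace (hXS i) (K i).isCompact subset_rfl
    refine ⟨q, hq, (countProd X).kappaMin_iff.2 ?_⟩
    rwa [traces_countProdCompacts, sUnion_boxes]
    -- Non-emptiness of the factors provides the traces for the coordinates that a box leaves free.
    exact fun v us _ i _ => (hK i).image _

end EffSpace

end Products

theorem corollary5 {k : ℕ}
    (X₁ : EffSpace.{u} k) (X₂ : EffSpace.{v} k) (hX₁ : X₁.IsComputable) (hX₂ : X₂.IsComputable)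
    (X : ℕ → EffSpace.{w} k) (hX : EffSpace.ComputableSequence X) :
    -- products with respect to the multi-representations by finite covers
    (RepComputable (X₁.kappa.prod X₂.kappa) (X₁.prod X₂).kappa
        (EffSpace.prodCompacts X₁ X₂ : Compacts X₁ × Compacts X₂ →. Compacts (X₁.prod X₂)) ∧
      (∃ f : Word k → OmegaWord k →. OmegaWord k, WordSeqComputable f ∧
        ∀ n : ℕ, Realizes (f (unary (n + 1)))
          (MultiRep.finProd fun i : Fin (n + 1) => (X i).kappa) (EffSpace.finProd X n).kappa
          (EffSpace.finProdCompacts X n :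
            (∀ i : Fin (n + 1), Compacts (X i)) →. Compacts (EffSpace.finProd X n))) ∧
      RepComputable (MultiRep.countProd fun i => (X i).kappa) (EffSpace.countProd X).kappa
        (EffSpace.countProdCompacts X :
          (∀ i, Compacts (X i)) →. Compacts (EffSpace.countProd X))) ∧
    -- products with respect to the multi-representations by minimal finite covers
    (RepComputable (X₁.kappaMin.prod X₂.kappaMin) (X₁.prod X₂).kappaMin
        (EffSpace.prodCompacts X₁ X₂ : Compacts X₁ × Compacts X₂ →. Compacts (X₁.prod X₂)) ∧
      (∃ f : Word k → OmegaWord k →. OmegaWord k, WordSeqComputable f ∧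
        ∀ n : ℕ, Realizes (f (unary (n + 1)))
          (MultiRep.finProd fun i : Fin (n + 1) => (X i).kappaMin) (EffSpace.finProd X n).kappaMin
          (EffSpace.finProdCompacts X n :
            (∀ i : Fin (n + 1), Compacts (X i)) →. Compacts (EffSpace.finProd X n))) ∧
      RepComputable (MultiRep.countProd fun i => (X i).kappaMin) (EffSpace.countProd X).kappaMin
        (PFun.res (EffSpace.countProdCompacts X) {K | ∀ i, (K i : Set (X i)).Nonempty})) := by
  obtain ⟨h1, h1'⟩ := EffSpace.computable_prodCompacts X₁ X₂ hX₁ hX₂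
  obtain ⟨f, hf, h2⟩ := EffSpace.computable_finProdCompacts X hX
  obtain ⟨h3, h3'⟩ := EffSpace.computable_countProdCompacts X hX
  exact ⟨⟨h1, ⟨f, hf, fun n => (h2 n).1⟩, h3⟩, ⟨h1', ⟨f, hf, fun n => (h2 n).2⟩, h3'⟩⟩
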